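/- **Conventions.** For an expansive matrix $R\in M_d(\mathbb Z)$ (all eigenvalues have modulus $>1$) and finite sets $B,L\subset\mathbb Z^d$ with $0\in B\cap L$ and $\#B=\#L$, the system $(R,B,L)$ is a *Hadamard triple* if the matrix $\frac1{\sqrt{\#B}}\big[e^{2\pi i\langle R^{-1}b,\ell\rangle}\big]_{\ell\in L,\,b\in B}$ is unitary. Put $m_B(x)=\frac1{\#B}\sum_{b\in B}e^{2\pi i\langle b,x\rangle}$ and $\tau_\ell(x)=(R^T)^{-1}(x+\ell)$ for $x\in\mathbb R^d$, $\ell\in L$. A compact set $K\subset\mathbb R^d$ is *invariant* for $(R,B,L)$ if $x\in K$, $\ell\in L$ and $|m_B(\tau_\ell(x))|>0$ imply $\tau_\ell(x)\in K$; it is a *minimal* compact invariant set if it is nonempty and contains no proper nonempty compact invariant subset. A *cycle* for $(R,L)$ is a set $\{x_0,\dots,x_{m-1}\}$, $m\ge1$, for which there are $\ell_0,\dots,\ell_{m-1}\in L$ with $x_{k+1}=\tau_{\ell_k}(x_k)$ for $0\le k<m$, where $x_m=x_0$. It is *extreme* for $(R,B,L)$ if $|m_B|=1$ at each of its points. The triple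 $(R,B,L)$ is *dynamically simple* if all its minimal compact invariant sets are extreme cycles. The *set generated* (with respect to $(R,L)$) by a family of cycles is the smallest set $\Lambda\subset\mathbb R^d$ that contains $-\mathcal C$ for every cycle $\mathcal C$ of the family and satisfies $R^T\Lambda+L\subset\Lambda$. For a finite set $A$ let $\delta_A=\frac1{\#A}\sum_{a\in A}\delta_a$, and let $\mu_{R,B}=\delta_{R^{-1}B}*\delta_{R^{-2}B}*\cdots$ (weak limit). A countable set $\Lambda$ is a *spectrum* for a Borel probability measure $\mu$ if $\{e^{2\pi i\langle\lambda,x\rangle}:\lambda\in\Lambda\}$ is an orthonormal basis of $L^2(\mu)$ (distinct $\lambda$ giving distinct, orthogonal elements). **Theorem.** Let $(R,B(i),L)$, $i=1,\dots,N$ ($N\ge1$), be Hadamard triples on $\mathbb R^d$ (with common $R$ and $L$), let $a_1,\dots,a_N\in\mathbb Z^r$ be distinct with $a_1=0$, put $B_1=\{a_1,\dots,a_N\}$, and let $(R_1,B_1,L_1)$ be a Hadamard triple on $\mathbb R^r$. Let $(\mathbf R,\mathbf B,\mathbf L)$ be the associated triple in quasi-product form on $\mathbb R^{r+d}$ with $C=0$,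 that is, $$\mathbf R=\begin{bmatrix}R_1&0\\ 0&R\end{bmatrix},\qquad \mathbf B=\left\{\begin{bmatrix}a_i\\ b\end{bmatrix}: 1\le i\le N,\ b\in B(i)\right\},\qquad \mathbf L=L_1\times L,$$ and assume that $(\mathbf R,\mathbf B,\mathbf L)$ is dynamically simple. Let $\Lambda_1$ be the set generated, with respect to $(R_1,L_1)$, by the extreme cycles for $(R_1,B_1,L_1)$, and let $\Lambda_2$ be the set generated, with respect to $(R,L)$, by those cycles for $(R,L)$ that are extreme for all the triples $(R,B(i),L)$, $i=1,\dots,N$. Then: 1. the infinite convolution $\mu_{\mathbf R,\mathbf B}$ converges weakly to a Borel probability measure, and $\Lambda_1\times\Lambda_2$ is a spectrum for $\mu_{\mathbf R,\mathbf B}$; 2. for $\mathbb P$-almost every $\omega=\omega_1\omega_2\cdots\in\{1,\dots,N\}^{\mathbb N}$, where $\mathbb P$ is the product probability with equal weights $1/N$, the infinite convolution $\mu_\omega=\delta_{R^{-1}B(\omega_1)}*\delta_{R^{-2}B(\omega_2)}*\cdots$ converges weakly to a Borel probability measure, and $\Lambda_2$ is a spectrum for $\mu_\omega$. -/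

import Mathlib

open MeasureTheory Filter Topology

noncomputable section

namespace RandomConv

/-- The real matrix with the entries of the integer matrix `R`. -/
def realMat {ι : Type*} (R : Matrix ι ι ℤ) : Matrix ι ι ℝ := R.map (fun z => (z : ℝ))

/-- The real vector with the entries of the integer vector `v`. -/
def realVec {ι : Type*} (v : ι → ℤ) : ι → ℝ := fun j => (v j : ℝ)

/-- `R` is expansive: all its (complex) eigenvalues have modulus strictly greater than `1`. -/
def IsExpansive {ι : Type*} [Fintype ι] [DecidableEq ι] (R : Matrix ι ι ℤ) : Prop :=
  ∀ z ∈ spectrum ℂ (R.map (fun n => (n : ℂ))), 1 < ‖z‖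

/-- The matrix `(1/√#B) [exp (2πi ⟨R⁻¹ b, ℓ⟩)]` with rows `ℓ ∈ L` and columns `b ∈ B`. -/
def hadamardMatrix {ι : Type*} [Fintype ι] [DecidableEq ι] (R : Matrix ι ι ℤ)
    (B L : Finset (ι → ℤ)) : Matrix L B ℂ :=
  Matrix.of fun (ℓ : L) (b : B) =>
    (1 / (Real.sqrt (B.card : ℝ) : ℂ)) *
      Complex.exp (2 * Real.pi * Complex.I *
        ((Matrix.mulVec (realMat R)⁻¹ (realVec b.1) ⬝ᵥ realVec ℓ.1 : ℝ) : ℂ))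

/-- Hadamard triples `(R, B, L)`. -/
structure IsHadamardTriple {ι : Type*} [Fintype ι] [DecidableEq ι] (R : Matrix ι ι ℤ)
    (B L : Finset (ι → ℤ)) : Prop where
  expansive : IsExpansive R
  zero_mem_B : (0 : ι → ℤ) ∈ B
  zero_mem_L : (0 : ι → ℤ) ∈ L
  card_eq : B.card = L.card
  unitary : (hadamardMatrix R B L).conjTranspose * hadamardMatrix R B L = 1

/-! ### The dynamical system of a triple -/

/-- `m_B(x) = (1/#B) ∑_{b ∈ B} exp (2πi ⟨b, x⟩)`. -/
def mask {ι : Type*} [Fintype ι] (B : Finset (ι → ℤ)) (x : ι → ℝ) : ℂ :=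
  (1 / (B.card : ℂ)) *
    ∑ b ∈ B, Complex.exp (2 * Real.pi * Complex.I * ((realVec b ⬝ᵥ x : ℝ) : ℂ))

/-- `τ_ℓ(x) = (Rᵀ)⁻¹ (x + ℓ)`. -/
def tau {ι : Type*} [Fintype ι] [DecidableEq ι] (R : Matrix ι ι ℤ) (ℓ : ι → ℤ)
    (x : ι → ℝ) : ι → ℝ :=
  Matrix.mulVec ((realMat R).transpose)⁻¹ (x + realVec ℓ)

/-- `K` is invariant: it contains `τ_ℓ(x)` whenever `x ∈ K` and the transition from `x` to
`τ_ℓ(x)` is possible, that is, `m_B(τ_ℓ(x)) ≠ 0`. -/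
def IsInvariant {ι : Type*} [Fintype ι] [DecidableEq ι] (R : Matrix ι ι ℤ)
    (B L : Finset (ι → ℤ)) (K : Set (ι → ℝ)) : Prop :=
  ∀ x ∈ K, ∀ ℓ ∈ L, 0 < ‖mask B (tau R ℓ x)‖ → tau R ℓ x ∈ K

/-- Minimal compact invariant sets: minimal among the nonempty compact invariant sets. -/
def IsMinimalCompactInvariant {ι : Type*} [Fintype ι] [DecidableEq ι] (R : Matrix ι ι ℤ)
    (B L : Finset (ι → ℤ)) (K : Set (ι → ℝ)) : Prop :=
  Minimal (fun S : Set (ι → ℝ) => S.Nonempty ∧ IsCompact S ∧ IsInvariant R B L S) K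

/-- Cycles `C = {x 0, …, x (m-1)}`, `m ≥ 1`, with `x (k+1) = τ_{ℓ k} (x k)`, `ℓ k ∈ L` and
`x m = x 0`; so `x 0` is the fixed point of `τ_{ℓ (m-1)} ∘ ⋯ ∘ τ_{ℓ 0}`. -/
def IsCycle {ι : Type*} [Fintype ι] [DecidableEq ι] (R : Matrix ι ι ℤ)
    (L : Finset (ι → ℤ)) (C : Set (ι → ℝ)) : Prop :=
  ∃ m : ℕ, 0 < m ∧ ∃ (ℓ : ℕ → ι → ℤ) (x : ℕ → ι → ℝ),
    (∀ k < m, ℓ k ∈ L ∧ x (k + 1) = tau R (ℓ k) (x k)) ∧ x m = x 0 ∧ C = x '' Set.Iio m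

/-- Extreme cycles for `(R, B, L)`: cycles on which `|m_B| = 1`. -/
def IsExtremeCycle {ι : Type*} [Fintype ι] [DecidableEq ι] (R : Matrix ι ι ℤ)
    (B L : Finset (ι → ℤ)) (C : Set (ι → ℝ)) : Prop :=
  IsCycle R L C ∧ ∀ x ∈ C, ‖mask B x‖ = 1

/-- `(R, B, L)` is dynamically simple: the only minimal compact invariant sets are the
extreme cycles. -/
def IsDynamicallySimple {ι : Type*} [Fintype ι] [DecidableEq ι] (R : Matrix ι ι ℤ)
    (B L : Finset (ι → ℤ)) : Prop :=
  ∀ K : Set (ι → ℝ), IsMinimalCompactInvariant R B L K → IsExtremeCycle R B L K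

/-- The set generated by `A`: the smallest set `S` with `-A ⊆ S` and `Rᵀ S + L ⊆ S`. -/
def generatedSet {ι : Type*} [Fintype ι] (R : Matrix ι ι ℤ) (L : Finset (ι → ℤ))
    (A : Set (ι → ℝ)) : Set (ι → ℝ) :=
  ⋂₀ {S | (∀ c ∈ A, -c ∈ S) ∧
    ∀ s ∈ S, ∀ ℓ ∈ L, Matrix.mulVec (realMat R).transpose s + realVec ℓ ∈ S}

/-! ### Infinite convolutions -/

/-- `δ_A`: the uniform probability measure on the finite set `A`. -/
def unif {ι : Type*} (A : Finset (ι → ℝ)) : Measure (ι → ℝ) :=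
  (A.card : ENNReal)⁻¹ • ∑ a ∈ A, Measure.dirac a

open scoped Classical in
/-- The finite set `R^{-k} B`. -/
def scaledDigits {ι : Type*} [Fintype ι] [DecidableEq ι] (R : Matrix ι ι ℤ)
    (B : Finset (ι → ℤ)) (k : ℕ) : Finset (ι → ℝ) :=
  B.image fun b => Matrix.mulVec ((realMat R)⁻¹ ^ k) (realVec b)

/-- `δ_{R⁻¹ D 0} ∗ δ_{R⁻² D 1} ∗ ⋯ ∗ δ_{R⁻ⁿ D (n-1)}`. -/
def partialConv {ι : Type*} [Fintype ι] [DecidableEq ι] (R : Matrix ι ι ℤ)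
    (D : ℕ → Finset (ι → ℤ)) : ℕ → Measure (ι → ℝ)
  | 0 => Measure.dirac 0
  | n + 1 => (partialConv R D n).conv (unif (scaledDigits R (D n) (n + 1)))

/-- The probability measure `μ` is the infinite convolution
`δ_{R⁻¹ D 0} ∗ δ_{R⁻² D 1} ∗ δ_{R⁻³ D 2} ∗ ⋯`, as a weak limit. Such a `μ` is unique. -/
def IsInfiniteConvolution {ι : Type*} [Fintype ι] [DecidableEq ι] (R : Matrix ι ι ℤ)
    (D : ℕ → Finset (ι → ℤ)) (μ : ProbabilityMeasure (ι → ℝ)) : Prop :=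
  ∀ f : BoundedContinuousFunction (ι → ℝ) ℝ,
    Tendsto (fun n => ∫ x, f x ∂(partialConv R D n)) atTop
      (𝓝 (∫ x, f x ∂(μ : Measure (ι → ℝ))))

/-! ### Spectra -/

/-- The exponential `x ↦ exp (2πi ⟨ξ, x⟩)`. -/
def expFun {ι : Type*} [Fintype ι] (ξ x : ι → ℝ) : ℂ :=
  Complex.exp (2 * Real.pi * Complex.I * ((ξ ⬝ᵥ x : ℝ) : ℂ))

theorem memLp_expFun {ι : Type*} [Fintype ι] (μ : Measure (ι → ℝ)) [IsFiniteMeasure μ]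
    (ξ : ι → ℝ) : MemLp (expFun ξ) 2 μ := by
  have hc : Continuous (expFun ξ) := by
    unfold expFun dotProduct
    fun_prop
  refine MemLp.of_bound hc.aestronglyMeasurable 1 (Eventually.of_forall fun x => ?_)
  have h : (2 * Real.pi * Complex.I * ((ξ ⬝ᵥ x : ℝ) : ℂ)) =
      ((2 * Real.pi * (ξ ⬝ᵥ x) : ℝ) : ℂ) * Complex.I := by
    push_cast
    ring
  rw [expFun, h, Complex.norm_exp_ofReal_mul_I]

/-- The exponential with frequency `ξ` as an element of `L²(μ)`. -/
def expLp {ι : Type*} [Fintype ι] (μ : Measure (ι → ℝ)) [IsFiniteMeasure μ]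
    (ξ : ι → ℝ) : Lp ℂ 2 μ :=
  (memLp_expFun μ ξ).toLp (expFun ξ)

/-- `Λ` is a spectrum of `μ`: it is countable and the exponentials with frequencies in `Λ` form
an orthonormal basis of `L²(μ)`. -/
def IsSpectrum {ι : Type*} [Fintype ι] (Λ : Set (ι → ℝ)) (μ : ProbabilityMeasure (ι → ℝ)) :
    Prop :=
  Λ.Countable ∧
  Orthonormal ℂ (fun ξ : Λ => expLp (μ : Measure (ι → ℝ)) ξ.1) ∧
  (Submodule.span ℂ
    (Set.range fun ξ : Λ => expLp (μ : Measure (ι → ℝ)) ξ.1)).topologicalClosure = ⊤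

/-! ### The quasi-product form -/

/-- `(Rq, Bq, Lq)` is in quasi-product form on `ℝ^{r+d}`, associated with the Hadamard triples
`(R, B i, L)`. Coordinates of `ℝ^{r+d}` are indexed by `Fin r ⊕ Fin d`, and indices
`i = 1, …, N` by `Fin N`. -/
structure IsQuasiProductForm {r d N : ℕ} [NeZero N]
    (Rq : Matrix (Fin r ⊕ Fin d) (Fin r ⊕ Fin d) ℤ) (Bq Lq : Finset (Fin r ⊕ Fin d → ℤ))
    (R₁ : Matrix (Fin r) (Fin r) ℤ) (C : Matrix (Fin d) (Fin r) ℤ)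
    (R : Matrix (Fin d) (Fin d) ℤ)
    (a : Fin N → Fin r → ℤ) (B : Fin N → Finset (Fin d → ℤ))
    (L₁ : Finset (Fin r → ℤ)) (L : Finset (Fin d → ℤ)) : Prop where
  hadamard : ∀ i, IsHadamardTriple R (B i) L
  a_zero : a 0 = 0
  a_injective : Function.Injective a
  hadamard₁ : IsHadamardTriple R₁ (Finset.univ.image a) L₁
  R_eq : Rq = Matrix.fromBlocks R₁ 0 C R
  B_eq : Bq = Finset.univ.biUnion fun i => (B i).image fun b => Sum.elim (a i) b
  L_eq : Lq = (L₁ ×ˢ L).image fun p => Sum.elim p.1 p.2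

/-- The product `Λ₁ × Λ₂` as a subset of `ℝ^{r+d}`. -/
def prodSet {r d : ℕ} (Λ₁ : Set (Fin r → ℝ)) (Λ₂ : Set (Fin d → ℝ)) :
    Set (Fin r ⊕ Fin d → ℝ) :=
  {x | x ∘ Sum.inl ∈ Λ₁ ∧ x ∘ Sum.inr ∈ Λ₂}

/-- The product probability `ℙ` on `{1, …, N}^ℕ` with equal weights `1/N`. -/
def wordMeasure (N : ℕ) [NeZero N] : Measure (ℕ → Fin N) :=
  Measure.infinitePi fun _ : ℕ => ProbabilityTheory.uniformOn (Set.univ : Set (Fin N))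

end RandomConv

end

namespace RandomConv

section Exponentials

@[simp] theorem realVec_zero {ι : Type*} : realVec (0 : ι → ℤ) = 0 := by
  ext; simp [realVec]

variable {ι : Type*} [Fintype ι]

theorem expFun_eq (ξ x : ι → ℝ) :
    expFun ξ x = Complex.exp (((2 * Real.pi * (ξ ⬝ᵥ x) : ℝ) : ℂ) * Complex.I) := by
  rw [expFun]; congr 1; push_cast; ring

@[simp] theorem norm_expFun (ξ x : ι → ℝ) : ‖expFun ξ x‖ = 1 := by
  rw [expFun_eq, Complex.norm_exp_ofReal_mul_I]

theorem expFun_add_left (ξ η x : ι → ℝ) : expFun (ξ + η) x = expFun ξ x * expFun η x := by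
  rw [expFun, expFun, expFun, ← Complex.exp_add, add_dotProduct]; congr 1; push_cast; ring

theorem expFun_comm (ξ x : ι → ℝ) : expFun ξ x = expFun x ξ := by
  rw [expFun, expFun, dotProduct_comm]

theorem expFun_add_right (ξ x y : ι → ℝ) : expFun ξ (x + y) = expFun ξ x * expFun ξ y := by
  rw [expFun_comm, expFun_add_left, expFun_comm x, expFun_comm y]

@[simp] theorem expFun_zero_left (x : ι → ℝ) : expFun 0 x = 1 := by simp [expFun]

@[simp] theorem expFun_zero_right (x : ι → ℝ) : expFun x 0 = 1 := by simp [expFun]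

theorem conj_expFun (ξ x : ι → ℝ) : (starRingEnd ℂ) (expFun ξ x) = expFun (-ξ) x := by
  rw [expFun_eq, expFun_eq, ← Complex.exp_conj, map_mul, Complex.conj_ofReal, Complex.conj_I,
    neg_dotProduct]
  congr 1
  push_cast
  ring

theorem expFun_sub_left (ξ η x : ι → ℝ) :
    expFun (ξ - η) x = expFun ξ x * (starRingEnd ℂ) (expFun η x) := by
  rw [sub_eq_add_neg, expFun_add_left, conj_expFun]

theorem expFun_eq_one_iff (ξ x : ι → ℝ) : expFun ξ x = 1 ↔ ∃ z : ℤ, ξ ⬝ᵥ x = z := by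
  have h2 : (2 * Real.pi * Complex.I) ≠ 0 := Complex.two_pi_I_ne_zero
  rw [expFun, Complex.exp_eq_one_iff]
  refine exists_congr fun z => ?_
  rw [mul_comm, mul_left_inj' h2]
  norm_cast

theorem continuous_expFun_left (x : ι → ℝ) : Continuous fun ξ => expFun ξ x := by
  unfold expFun dotProduct
  fun_prop

theorem continuous_expFun (ξ : ι → ℝ) : Continuous (expFun ξ) := by
  unfold expFun dotProduct
  fun_prop

theorem expFun_mulVec {κ : Type*} [Fintype κ] (M : Matrix ι κ ℝ) (ξ : ι → ℝ) (x : κ → ℝ) :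
    expFun ξ (M.mulVec x) = expFun (M.transpose.mulVec ξ) x := by
  rw [expFun, expFun, Matrix.dotProduct_mulVec, Matrix.mulVec_transpose]

theorem realVec_dotProduct (u v : ι → ℤ) : realVec u ⬝ᵥ realVec v = ((u ⬝ᵥ v : ℤ) : ℝ) := by
  simp [realVec, dotProduct]

theorem realMat_mulVec (R : Matrix ι ι ℤ) (v : ι → ℤ) :
    (realMat R).mulVec (realVec v) = realVec (R.mulVec v) := by
  ext; simp [realMat, realVec, Matrix.mulVec, dotProduct]

end Exponentials

section Mask

theorem sqrt_card_mul_self {α : Type*} (B : Finset α) :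
    (1 / (Real.sqrt (B.card : ℝ) : ℂ)) * (1 / (Real.sqrt (B.card : ℝ) : ℂ)) = 1 / (B.card : ℂ) := by
  rw [div_mul_div_comm, one_mul, ← Complex.ofReal_mul, Real.mul_self_sqrt (Nat.cast_nonneg _)]
  simp

variable {ι : Type*} [Fintype ι]

theorem mask_eq (B : Finset (ι → ℤ)) (x : ι → ℝ) :
    mask B x = (1 / (B.card : ℂ)) * ∑ b ∈ B, expFun x (realVec b) := by
  rw [mask]
  congr 1
  exact Finset.sum_congr rfl fun b _ => expFun_comm (realVec b) x

theorem norm_mask_le_one (B : Finset (ι → ℤ)) (x : ι → ℝ) : ‖mask B x‖ ≤ 1 := by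
  rw [mask_eq, norm_mul]
  have h : ‖∑ b ∈ B, expFun x (realVec b)‖ ≤ B.card := by
    refine (norm_sum_le _ _).trans ?_
    simp
  rcases B.card.eq_zero_or_pos with h0 | h0
  · simp [h0]
  · have : (0 : ℝ) < B.card := by exact_mod_cast h0
    simp only [one_div, norm_inv, Complex.norm_natCast]
    rw [inv_mul_le_iff₀ this]
    simpa using h

theorem mask_zero {B : Finset (ι → ℤ)} (hB : B.Nonempty) : mask B 0 = 1 := by
  have : (B.card : ℂ) ≠ 0 := by exact_mod_cast hB.card_pos.ne'
  rw [mask_eq]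
  simp [this]

/-- Translation by a vector that has integral products with the digits leaves the mask fixed. -/
theorem mask_add_of_integral {B : Finset (ι → ℤ)} {x γ : ι → ℝ}
    (hγ : ∀ b ∈ B, ∃ z : ℤ, γ ⬝ᵥ realVec b = z) : mask B (x + γ) = mask B x := by
  rw [mask_eq, mask_eq]
  congr 1
  refine Finset.sum_congr rfl fun b hb => ?_
  rw [expFun_add_left, (expFun_eq_one_iff _ _).2 (hγ b hb), mul_one]

/-- Where the mask has modulus one, all digits have integral products. -/
theorem integral_of_norm_mask_eq_one {B : Finset (ι → ℤ)} (h0 : 0 ∈ B) {x : ι → ℝ}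
    (hx : ‖mask B x‖ = 1) : ∀ b ∈ B, ∃ z : ℤ, x ⬝ᵥ realVec b = z := by
  classical
  intro b hb
  rw [← expFun_eq_one_iff]
  by_cases hb0 : b = 0
  · simp [hb0]
  have hc : (0 : ℝ) < B.card := by exact_mod_cast Finset.card_pos.2 ⟨0, h0⟩
  have hsum : ‖∑ b ∈ B, expFun x (realVec b)‖ = B.card := by
    rw [mask_eq, norm_mul] at hx
    simp only [one_div, norm_inv, Complex.norm_natCast] at hx
    field_simp at hx
    exact hx
  have hsub : ({0, b} : Finset (ι → ℤ)) ⊆ B := by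
    intro y hy
    simp only [Finset.mem_insert, Finset.mem_singleton] at hy
    rcases hy with rfl | rfl <;> assumption
  have h2 : ({0, b} : Finset (ι → ℤ)).card = 2 := Finset.card_pair (Ne.symm hb0)
  have hle : (B.card : ℝ) ≤ ‖1 + expFun x (realVec b)‖ + (B.card - 2) := by
    have hs := Finset.sum_sdiff (f := fun b => expFun x (realVec b)) hsub
    rw [Finset.sum_pair (Ne.symm hb0), realVec_zero, expFun_zero_right] at hs
    have hn : ‖∑ b ∈ B \ {0, b}, expFun x (realVec b)‖ ≤ B.card - 2 := by
      refine (norm_sum_le _ _).trans ?_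
      simp only [norm_expFun, Finset.sum_const, nsmul_eq_mul, mul_one]
      rw [Finset.card_sdiff_of_subset hsub, h2, Nat.cast_sub (h2 ▸ Finset.card_le_card hsub)]
      simp
    rw [← hs] at hsum
    rw [← hsum]
    refine (norm_add_le _ _).trans ?_
    rw [hsum]
    linarith
  have h3 : (2 : ℝ) ≤ ‖1 + expFun x (realVec b)‖ := by linarith
  have h1 := norm_expFun x (realVec b)
  generalize expFun x (realVec b) = w at h1 h3
  have e1 : w.re ^ 2 + w.im ^ 2 = 1 := by
    have := Complex.sq_norm w
    rw [h1, Complex.normSq_apply] at this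
    linarith
  have e2 : (4 : ℝ) ≤ (1 + w.re) ^ 2 + w.im ^ 2 := by
    have := Complex.sq_norm (1 + w)
    rw [Complex.normSq_apply] at this
    simp only [Complex.add_re, Complex.one_re, Complex.add_im, Complex.one_im, zero_add] at this
    nlinarith
  have hre : 1 ≤ w.re := by linarith
  have him : w.im = 0 := by nlinarith [sq_nonneg w.im]
  have hre' : w.re = 1 := by nlinarith [sq_nonneg w.im]
  exact Complex.ext hre' him

theorem norm_mask_eq_one_of_integral {B : Finset (ι → ℤ)} (hB : B.Nonempty) {x : ι → ℝ}
    (hx : ∀ b ∈ B, ∃ z : ℤ, x ⬝ᵥ realVec b = z) : ‖mask B x‖ = 1 := by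
  have := mask_add_of_integral (x := 0) hx
  rw [zero_add, mask_zero hB] at this
  simp [this]

end Mask

section Hadamard

variable {ι : Type*} [Fintype ι] [DecidableEq ι] {R : Matrix ι ι ℤ} {B L : Finset (ι → ℤ)}

/-- The matrix `(Rᵀ)⁻¹` of the dual contraction. -/
noncomputable def dualInv (R : Matrix ι ι ℤ) : Matrix ι ι ℝ := ((realMat R).transpose)⁻¹

theorem tau_eq (ℓ : ι → ℤ) (x : ι → ℝ) : tau R ℓ x = (dualInv R).mulVec (x + realVec ℓ) := rfl

theorem transpose_dualInv_pow (R : Matrix ι ι ℤ) (n : ℕ) :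
    ((dualInv R) ^ n).transpose = (realMat R)⁻¹ ^ n := by
  rw [dualInv, Matrix.transpose_pow, Matrix.transpose_nonsing_inv, Matrix.transpose_transpose]

theorem IsExpansive.isUnit_det (h : IsExpansive R) : IsUnit (realMat R).det := by
  rw [isUnit_iff_ne_zero]
  intro h0
  have hz : R.det = 0 := by
    have := (Int.castRingHom ℝ).map_det R
    rw [RingHom.mapMatrix_apply] at this
    change ((R.det : ℤ) : ℝ) = (realMat R).det at this
    rw [h0] at this
    exact_mod_cast this
  have hc : (R.map (fun n => (n : ℂ))).det = 0 := by
    have := (Int.castRingHom ℂ).map_det R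
    rw [RingHom.mapMatrix_apply, hz] at this
    simpa using this.symm
  have := h 0 (by
    rw [spectrum.zero_mem_iff, Matrix.isUnit_iff_isUnit_det, hc]
    simp)
  simp at this
  linarith

theorem IsExpansive.dualInv_mulVec (h : IsExpansive R) (x : ι → ℝ) :
    (dualInv R).mulVec ((realMat R).transpose.mulVec x) = x := by
  rw [Matrix.mulVec_mulVec, dualInv, Matrix.nonsing_inv_mul _ (by
    rw [Matrix.det_transpose]; exact h.isUnit_det), Matrix.one_mulVec]

theorem IsExpansive.mulVec_dualInv (h : IsExpansive R) (x : ι → ℝ) :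
    (realMat R).transpose.mulVec ((dualInv R).mulVec x) = x := by
  rw [Matrix.mulVec_mulVec, dualInv, Matrix.mul_nonsing_inv _ (by
    rw [Matrix.det_transpose]; exact h.isUnit_det), Matrix.one_mulVec]

theorem IsExpansive.inv_pow_mulVec_injective (h : IsExpansive R) (k : ℕ) :
    Function.Injective ((realMat R)⁻¹ ^ k).mulVec := by
  refine Matrix.mulVec_injective_of_isUnit (IsUnit.pow _ ?_)
  rw [Matrix.isUnit_nonsing_inv_iff, Matrix.isUnit_iff_isUnit_det]
  exact h.isUnit_det

theorem hadamardMatrix_apply (ℓ : L) (b : B) :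
    hadamardMatrix R B L ℓ b = (1 / (Real.sqrt (B.card : ℝ) : ℂ)) *
      expFun ((dualInv R).mulVec (realVec ℓ.1)) (realVec b.1) := by
  have h1 := transpose_dualInv_pow R 1
  rw [pow_one, pow_one] at h1
  rw [expFun_comm, expFun_mulVec, h1]
  rfl

theorem IsHadamardTriple.nonempty_B (h : IsHadamardTriple R B L) : B.Nonempty := ⟨0, h.zero_mem_B⟩

theorem hadamardMatrix_mul_conjTranspose_apply (ℓ ℓ' : L) :
    (hadamardMatrix R B L * (hadamardMatrix R B L).conjTranspose) ℓ ℓ' =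
      mask B ((dualInv R).mulVec (realVec ℓ.1 - realVec ℓ'.1)) := by
  rw [Matrix.mul_apply, mask_eq, Matrix.mulVec_sub, ← sqrt_card_mul_self B, Finset.mul_sum,
    ← Finset.sum_coe_sort B]
  refine Finset.sum_congr rfl fun b _ => ?_
  rw [Matrix.conjTranspose_apply, hadamardMatrix_apply, hadamardMatrix_apply, expFun_sub_left]
  simp only [star_mul', RCLike.star_def, map_div₀, map_one, Complex.conj_ofReal]
  ring

theorem IsHadamardTriple.mask_dualInv_sub (h : IsHadamardTriple R B L) {ℓ ℓ' : ι → ℤ}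
    (hℓ : ℓ ∈ L) (hℓ' : ℓ' ∈ L) (hne : ℓ ≠ ℓ') :
    mask B ((dualInv R).mulVec (realVec ℓ - realVec ℓ')) = 0 := by
  have hu : hadamardMatrix R B L * (hadamardMatrix R B L).conjTranspose = 1 :=
    (Matrix.mul_eq_one_comm_of_card_eq _ _ _ (by simp [h.card_eq])).1 h.unitary
  rw [← hadamardMatrix_mul_conjTranspose_apply ⟨ℓ, hℓ⟩ ⟨ℓ', hℓ'⟩, hu,
    Matrix.one_apply_ne (by simpa using hne)]

theorem IsHadamardTriple.sum_norm_mask_tau (h : IsHadamardTriple R B L) (x : ι → ℝ) :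
    ∑ ℓ ∈ L, ‖mask B (tau R ℓ x)‖ ^ 2 = 1 := by
  have hc : (0 : ℝ) < B.card := by exact_mod_cast h.nonempty_B.card_pos
  have hs : (0 : ℝ) < Real.sqrt B.card := Real.sqrt_pos.2 hc
  set v : B → ℂ := fun b => expFun ((dualInv R).mulVec x) (realVec b.1) with hv
  set H := hadamardMatrix R B L with hH
  have hm : ∀ ℓ : L, mask B (tau R ℓ.1 x) = (1 / (Real.sqrt (B.card : ℝ) : ℂ)) * H.mulVec v ℓ := by
    intro ℓ
    rw [mask_eq, tau_eq, Matrix.mulVec_add, ← sqrt_card_mul_self B, mul_assoc]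
    congr 1
    rw [Matrix.mulVec, dotProduct, Finset.mul_sum, ← Finset.sum_coe_sort]
    refine Finset.sum_congr rfl fun b _ => ?_
    rw [hH, hadamardMatrix_apply, expFun_add_left, hv]
    ring
  have key : star (H.mulVec v) ⬝ᵥ H.mulVec v = (B.card : ℂ) := by
    rw [Matrix.star_mulVec, ← Matrix.dotProduct_mulVec, Matrix.mulVec_mulVec, h.unitary,
      Matrix.one_mulVec, dotProduct]
    have : ∀ b : B, star v b * v b = 1 := by
      intro b
      rw [Pi.star_apply, RCLike.star_def, mul_comm, Complex.mul_conj', hv, norm_expFun]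
      simp
    rw [Finset.sum_congr rfl fun b _ => this b]
    simp
  have key' : ∑ ℓ : L, ‖H.mulVec v ℓ‖ ^ 2 = B.card := by
    rw [dotProduct] at key
    have h2 : ∀ ℓ : L, star (H.mulVec v) ℓ * H.mulVec v ℓ = ((‖H.mulVec v ℓ‖ ^ 2 : ℝ) : ℂ) := by
      intro ℓ
      rw [Pi.star_apply, RCLike.star_def, mul_comm, Complex.mul_conj']
      push_cast
      rfl
    simp only [h2] at key
    exact_mod_cast key
  rw [← Finset.sum_coe_sort]
  simp only [hm, norm_mul, mul_pow]
  rw [← Finset.mul_sum, key']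
  simp only [one_div, norm_inv, Complex.norm_real, Real.norm_eq_abs, abs_of_pos hs, inv_pow,
    Real.sq_sqrt hc.le]
  field_simp

end Hadamard

section Decay

variable {ι : Type*} [Fintype ι] [DecidableEq ι] {R : Matrix ι ι ℤ}

attribute [local instance] Matrix.linftyOpNormedRing Matrix.linftyOpNormedAlgebra in
/-- A complex matrix whose eigenvalues lie in the open unit disc has geometrically decaying
powers. -/
theorem exists_norm_pow_mulVec_le (M : Matrix ι ι ℂ) (hM : ∀ z ∈ spectrum ℂ M, ‖z‖ < 1) :
    ∃ C ρ : ℝ, 0 < C ∧ 0 < ρ ∧ ρ < 1 ∧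
      ∀ (n : ℕ) (x : ι → ℂ), ‖(M ^ n).mulVec x‖ ≤ C * ρ ^ n * ‖x‖ := by
  have : CompleteSpace (Matrix ι ι ℂ) := FiniteDimensional.complete ℂ _
  have hr : spectralRadius ℂ M < 1 := by
    rcases (spectrum ℂ M).eq_empty_or_nonempty with h | h
    · simp [spectralRadius, h]
    · have := spectrum.spectralRadius_lt_of_forall_lt_of_nonempty (r := 1) h
        (fun z hz => by exact_mod_cast hM z hz)
      simpa using this
  obtain ⟨q, hq1, hq2⟩ := ENNReal.lt_iff_exists_nnreal_btwn.1 hr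
  have hq3 : (0 : ℝ) < q := by
    have : (0 : ENNReal) < q := lt_of_le_of_lt bot_le hq1
    exact_mod_cast this
  have hev := (spectrum.pow_nnnorm_pow_one_div_tendsto_nhds_spectralRadius M).eventually_lt_const
    hq1
  have hO : (fun n : ℕ => M ^ n) =O[atTop] fun n => (q : ℝ) ^ n := by
    refine Asymptotics.IsBigO.of_bound 1 ?_
    filter_upwards [hev, eventually_gt_atTop 0] with n hn hn0
    have hn1 : (n : ℝ) ≠ 0 := by exact_mod_cast hn0.ne'
    have h1 : ((‖M ^ n‖₊ : ENNReal) ^ (1 / n : ℝ)) ^ (n : ℝ) ≤ (q : ENNReal) ^ (n : ℝ) :=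
      ENNReal.rpow_le_rpow hn.le (Nat.cast_nonneg n)
    rw [← ENNReal.rpow_mul, one_div_mul_cancel hn1, ENNReal.rpow_one, ENNReal.rpow_natCast] at h1
    have h2 : ‖M ^ n‖₊ ≤ q ^ n := by exact_mod_cast h1
    have h3 : ‖M ^ n‖ ≤ (q : ℝ) ^ n := by exact_mod_cast h2
    simpa using h3
  obtain ⟨C, hC, hb⟩ := Asymptotics.bound_of_isBigO_nat_atTop hO
  refine ⟨C, q, hC, hq3, by exact_mod_cast hq2, fun n x => ?_⟩
  refine (Matrix.linfty_opNorm_mulVec _ _).trans ?_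
  gcongr
  have := hb (x := n) (by positivity)
  rwa [Real.norm_of_nonneg (by positivity : (0 : ℝ) ≤ (q : ℝ) ^ n)] at this

theorem IsExpansive.exists_norm_inv_pow_mulVec_le (h : IsExpansive R) :
    ∃ C ρ : ℝ, 0 < C ∧ 0 < ρ ∧ ρ < 1 ∧
      ∀ (n : ℕ) (x : ι → ℝ), ‖((realMat R)⁻¹ ^ n).mulVec x‖ ≤ C * ρ ^ n * ‖x‖ := by
  set M : Matrix ι ι ℂ := ((realMat R)⁻¹).map ((↑) : ℝ → ℂ) with hM
  have hMR : M * R.map (fun n => (n : ℂ)) = 1 := by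
    have h1 : R.map (fun n => (n : ℂ)) = (realMat R).map ((↑) : ℝ → ℂ) := by
      ext i j; simp [realMat]
    have h2 := congr_arg (Complex.ofRealHom.mapMatrix)
      (Matrix.nonsing_inv_mul _ h.isUnit_det)
    rw [map_mul, map_one] at h2
    rw [h1]
    exact h2
  set U : (Matrix ι ι ℂ)ˣ := ⟨M, R.map (fun n => (n : ℂ)), hMR,
    mul_eq_one_comm.1 hMR⟩ with hU
  obtain ⟨C, ρ, hC, hρ0, hρ1, hb⟩ := exists_norm_pow_mulVec_le M (by
    intro z hz
    have hz0 : z ≠ 0 := by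
      rintro rfl
      exact (spectrum.zero_notMem_iff ℂ).2 U.isUnit hz
    have := h z⁻¹ (spectrum.inv_mem_iff (r := Units.mk0 z hz0) (a := U) |>.1 hz)
    rw [norm_inv] at this
    exact (one_lt_inv₀ (norm_pos_iff.2 hz0)).1 this)
  refine ⟨C, ρ, hC, hρ0, hρ1, fun n x => ?_⟩
  have hnorm : ∀ y : ι → ℝ, ‖fun i => (y i : ℂ)‖ = ‖y‖ := fun y => by
    simp [Pi.norm_def]
  have hpow : M ^ n = ((realMat R)⁻¹ ^ n).map ((↑) : ℝ → ℂ) := by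
    have := map_pow Complex.ofRealHom.mapMatrix ((realMat R)⁻¹) n
    exact this.symm
  have := hb n (fun i => (x i : ℂ))
  rw [hnorm] at this
  refine le_trans (le_of_eq ?_) this
  rw [← hnorm, hpow]
  congr 1
  ext i
  simp [Matrix.mulVec, dotProduct]

theorem norm_mulVec_transpose_le (M : Matrix ι ι ℝ) {c : ℝ}
    (h : ∀ x, ‖M.mulVec x‖ ≤ c * ‖x‖) (x : ι → ℝ) :
    ‖M.transpose.mulVec x‖ ≤ Fintype.card ι * c * ‖x‖ := by
  have he : ∀ i j, |M i j| ≤ c := by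
    intro i j
    have h1 := h (Pi.single j 1)
    rw [Matrix.mulVec_single_one, Pi.norm_single, norm_one, mul_one] at h1
    exact (norm_le_pi_norm (M.col j) i).trans h1
  rcases isEmpty_or_nonempty ι with hι | hι
  · simp [Subsingleton.elim x 0]
  rw [pi_norm_le_iff_of_nonempty]
  intro j
  rw [Matrix.mulVec, dotProduct]
  refine (norm_sum_le _ _).trans ?_
  refine (Finset.sum_le_sum (g := fun _ => c * ‖x‖) fun i _ => ?_).trans ?_
  · rw [norm_mul]
    exact mul_le_mul (he i j) (norm_le_pi_norm x i) (norm_nonneg _) ((abs_nonneg _).trans (he i j))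
  · simp [mul_assoc]

theorem IsExpansive.exists_norm_dualInv_pow_mulVec_le (h : IsExpansive R) :
    ∃ C ρ : ℝ, 0 ≤ C ∧ 0 < ρ ∧ ρ < 1 ∧
      ∀ (n : ℕ) (x : ι → ℝ), ‖(dualInv R ^ n).mulVec x‖ ≤ C * ρ ^ n * ‖x‖ := by
  obtain ⟨C, ρ, hC, hρ0, hρ1, hb⟩ := h.exists_norm_inv_pow_mulVec_le
  refine ⟨Fintype.card ι * C, ρ, by positivity, hρ0, hρ1, fun n x => ?_⟩
  rw [← Matrix.transpose_transpose (dualInv R ^ n), transpose_dualInv_pow, mul_assoc _ C]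
  exact norm_mulVec_transpose_le _ (hb n) x

theorem IsExpansive.tendsto_dualInv_pow_mulVec (h : IsExpansive R) (x : ι → ℝ) :
    Tendsto (fun n => (dualInv R ^ n).mulVec x) atTop (𝓝 0) := by
  obtain ⟨C, ρ, -, hρ0, hρ1, hb⟩ := h.exists_norm_dualInv_pow_mulVec_le
  refine squeeze_zero_norm (fun n => hb n x) ?_
  simpa using ((tendsto_pow_atTop_nhds_zero_of_lt_one hρ0.le hρ1).const_mul C).mul_const ‖x‖

end Decay

section Convolution

theorem isProbabilityMeasure_unif {ι : Type*} {A : Finset (ι → ℝ)} (hA : A.Nonempty) :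
    IsProbabilityMeasure (unif A) := by
  refine ⟨?_⟩
  have : (A.card : ENNReal) ≠ 0 := by exact_mod_cast hA.card_pos.ne'
  simp [unif, ENNReal.inv_mul_cancel this]

variable {ι : Type*} [Fintype ι]

theorem integral_unif {E : Type*} [NormedAddCommGroup E] [NormedSpace ℝ E] [CompleteSpace E]
    (A : Finset (ι → ℝ)) (f : (ι → ℝ) → E) :
    ∫ x, f x ∂(unif A) = (A.card : ℝ)⁻¹ • ∑ a ∈ A, f a := by
  rw [unif, integral_smul_measure, integral_finsetSum_measure fun a _ => integrable_dirac (by simp)]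
  simp

theorem ae_mem_unif (A : Finset (ι → ℝ)) : ∀ᵐ x ∂(unif A), x ∈ A := by
  rw [unif]
  refine Measure.ae_smul_measure ?_ _
  rw [ae_iff, Measure.finsetSum_apply]
  refine Finset.sum_eq_zero fun a ha => ?_
  have hm : MeasurableSet {x | x ∉ A} := A.measurableSet.compl
  rw [Measure.dirac_apply' _ hm]
  simpa using ha

theorem integrable_expFun {μ : Measure (ι → ℝ)} [IsFiniteMeasure μ] (ξ : ι → ℝ) :
    Integrable (expFun ξ) μ :=
  Integrable.of_bound (continuous_expFun ξ).aestronglyMeasurable 1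
    (Eventually.of_forall fun x => (norm_expFun ξ x).le)

variable [DecidableEq ι] {R : Matrix ι ι ℤ}

theorem scaledDigits_nonempty {B : Finset (ι → ℤ)} (hB : B.Nonempty) (k : ℕ) :
    (scaledDigits R B k).Nonempty := by
  classical
  exact hB.image _

theorem isProbabilityMeasure_partialConv {D : ℕ → Finset (ι → ℤ)} (hD : ∀ n, (D n).Nonempty)
    (n : ℕ) : IsProbabilityMeasure (partialConv R D n) := by
  induction n with
  | zero => rw [partialConv]; infer_instance
  | succ n ih =>
    have := isProbabilityMeasure_unif (scaledDigits_nonempty (R := R) (hD n) (n + 1))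
    rw [partialConv]
    infer_instance

theorem integral_expFun_unif (hR : IsExpansive R) (B : Finset (ι → ℤ)) (k : ℕ) (ξ : ι → ℝ) :
    ∫ x, expFun ξ x ∂(unif (scaledDigits R B k)) = mask B ((dualInv R ^ k).mulVec ξ) := by
  classical
  have hinj : Function.Injective fun b : ι → ℤ => ((realMat R)⁻¹ ^ k).mulVec (realVec b) := by
    intro b b' hbb
    have h1 : realVec b = realVec b' := hR.inv_pow_mulVec_injective k hbb
    ext i
    have h2 : (b i : ℝ) = b' i := congr_fun h1 i
    exact_mod_cast h2
  have he : scaledDigits R B k =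
      B.image fun b => ((realMat R)⁻¹ ^ k).mulVec (realVec b) := by
    unfold scaledDigits; congr
  rw [integral_unif, he, Finset.card_image_of_injective _ hinj,
    Finset.sum_image (fun _ _ _ _ h => hinj h), mask_eq, Complex.real_smul]
  congr 1
  · simp
  · refine Finset.sum_congr rfl fun b _ => ?_
    rw [expFun_mulVec, ← transpose_dualInv_pow, Matrix.transpose_transpose]

theorem integral_expFun_partialConv (hR : IsExpansive R) {D : ℕ → Finset (ι → ℤ)}
    (hD : ∀ n, (D n).Nonempty) (n : ℕ) (ξ : ι → ℝ) :
    ∫ x, expFun ξ x ∂(partialConv R D n) =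
      ∏ k ∈ Finset.range n, mask (D k) ((dualInv R ^ (k + 1)).mulVec ξ) := by
  induction n with
  | zero => simp [partialConv]
  | succ n ih =>
    have := isProbabilityMeasure_unif (scaledDigits_nonempty (R := R) (hD n) (n + 1))
    have := isProbabilityMeasure_partialConv (R := R) hD n
    rw [Finset.prod_range_succ, ← ih, partialConv, integral_conv (integrable_expFun ξ),
      ← integral_expFun_unif hR]
    simp only [expFun_add_right, integral_const_mul, integral_mul_const]

/-- The Fourier transform of an infinite convolution is the infinite product of the masks. -/
theorem IsInfiniteConvolution.tendsto_prod_mask (hR : IsExpansive R) {D : ℕ → Finset (ι → ℤ)}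
    (hD : ∀ n, (D n).Nonempty) {μ : ProbabilityMeasure (ι → ℝ)}
    (h : IsInfiniteConvolution R D μ) (ξ : ι → ℝ) :
    Tendsto (fun n => ∏ k ∈ Finset.range n, mask (D k) ((dualInv R ^ (k + 1)).mulVec ξ)) atTop
      (𝓝 (∫ x, expFun ξ x ∂(μ : Measure (ι → ℝ)))) := by
  let μs : ℕ → ProbabilityMeasure (ι → ℝ) := fun n =>
    ⟨partialConv R D n, isProbabilityMeasure_partialConv hD n⟩
  have hlim : Tendsto μs atTop (𝓝 μ) :=
    ProbabilityMeasure.tendsto_iff_forall_integral_tendsto.2 h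
  have := (ProbabilityMeasure.tendsto_iff_forall_integral_rclike_tendsto ℂ).1 hlim
    (BoundedContinuousFunction.ofNormedAddCommGroup (expFun ξ) (continuous_expFun ξ) 1
      fun x => (norm_expFun ξ x).le)
  refine this.congr fun n => ?_
  rw [← integral_expFun_partialConv hR hD]
  rfl

/-- Infinite convolutions with uniformly bounded digit sets converge weakly. -/
theorem exists_isInfiniteConvolution (hR : IsExpansive R) {D : ℕ → Finset (ι → ℤ)}
    (hD : ∀ n, (D n).Nonempty) {c : ℝ} (hc : ∀ n, ∀ b ∈ D n, ‖realVec b‖ ≤ c) :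
    ∃ μ : ProbabilityMeasure (ι → ℝ), IsInfiniteConvolution R D μ := by
  classical
  set ν : ℕ → Measure (ι → ℝ) := fun n => unif (scaledDigits R (D n) (n + 1)) with hν
  have : ∀ n, IsProbabilityMeasure (ν n) := fun n =>
    isProbabilityMeasure_unif (scaledDigits_nonempty (hD n) (n + 1))
  set P := Measure.infinitePi ν with hP
  set S : ℕ → (ℕ → ι → ℝ) → (ι → ℝ) := fun n y => ∑ k ∈ Finset.range n, y k with hS
  have hSm : ∀ n, Measurable (S n) := fun n =>
    Finset.measurable_sum _ fun k _ => measurable_pi_apply k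
  have hlaw : ∀ n, P.map (S n) = partialConv R D n := by
    intro n
    induction n with
    | zero => simp [hS, partialConv, Measure.map_const]
    | succ n ih =>
      have hind : ProbabilityTheory.iIndepFun (fun k (y : ℕ → ι → ℝ) => y k) P :=
        ProbabilityTheory.iIndepFun_infinitePi (X := fun _ x => x) fun _ => measurable_id
      have h2 := (hind.indepFun_sum_range_succ (fun k => measurable_pi_apply k) n)
      have hSe : S n = ∑ j ∈ Finset.range n, fun y : ℕ → ι → ℝ => y j := by
        ext y : 1; simp [hS, Finset.sum_apply]
      rw [← hSe] at h2
      have h3 := h2.map_add_eq_map_conv_map (hSm n) (measurable_pi_apply n)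
      rw [ih, hP, Measure.infinitePi_map_eval] at h3
      rw [partialConv, ← h3]
      congr 1
      ext y : 1
      simp [hS, Finset.sum_range_succ]
  obtain ⟨C, ρ, hC, hρ0, hρ1, hb⟩ := hR.exists_norm_inv_pow_mulVec_le
  have hae : ∀ᵐ y ∂P, ∀ n, y n ∈ scaledDigits R (D n) (n + 1) := by
    rw [ae_all_iff]
    intro n
    have := ae_mem_unif (scaledDigits R (D n) (n + 1))
    change ∀ᵐ x ∂(ν n), _ at this
    rw [← Measure.infinitePi_map_eval ν n] at this
    exact ae_of_ae_map (measurable_pi_apply n).aemeasurable this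
  have hconv : ∀ᵐ y ∂P, ∃ s, Tendsto (fun n => S n y) atTop (𝓝 s) := by
    filter_upwards [hae] with y hy
    have hsum : Summable y := by
      refine Summable.of_norm_bounded (g := fun n => C * ρ ^ (n + 1) * c) ?_ fun n => ?_
      · exact (((summable_geometric_of_lt_one hρ0.le hρ1).comp_injective
          (add_left_injective 1)).mul_left C).mul_right c
      · have h1 := hy n
        simp only [scaledDigits, Finset.mem_image] at h1
        obtain ⟨b, hbD, hby⟩ := h1
        rw [← hby]
        refine (hb (n + 1) _).trans ?_
        gcongr
        exact hc n b hbD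
    exact ⟨_, hsum.hasSum.tendsto_sum_nat⟩
  obtain ⟨T, hTm, hT⟩ := measurable_limit_of_tendsto_metrizable_ae
    (fun n => (hSm n).aemeasurable) hconv
  refine ⟨⟨P.map T, Measure.isProbabilityMeasure_map hTm.aemeasurable⟩, fun f => ?_⟩
  change Tendsto _ _ (𝓝 (∫ x, f x ∂(P.map T)))
  simp only [← hlaw]
  rw [integral_map hTm.aemeasurable f.continuous.aestronglyMeasurable]
  simp_rw [fun n => integral_map (hSm n).aemeasurable
    (f.continuous.aestronglyMeasurable (μ := P.map (S n)))]
  refine tendsto_integral_of_dominated_convergence (fun _ => ‖f‖)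
    (fun n => (f.continuous.measurable.comp (hSm n)).aestronglyMeasurable)
    (integrable_const _) (fun n => Eventually.of_forall fun y => f.norm_coe_le_norm _) ?_
  filter_upwards [hT] with y hy
  exact (f.continuous.tendsto _).comp hy

end Convolution

section GeneratedSets

variable {ι : Type*} [Fintype ι] {R : Matrix ι ι ℤ} {L : Finset (ι → ℤ)}

theorem neg_mem_generatedSet {A : Set (ι → ℝ)} {c : ι → ℝ} (hc : c ∈ A) :
    -c ∈ generatedSet R L A := fun _ hS => hS.1 c hc

theorem mulVec_add_mem_generatedSet {A : Set (ι → ℝ)} {s : ι → ℝ}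
    (hs : s ∈ generatedSet R L A) {ℓ : ι → ℤ} (hℓ : ℓ ∈ L) :
    (realMat R).transpose.mulVec s + realVec ℓ ∈ generatedSet R L A :=
  fun S hS => hS.2 s (hs S hS) ℓ hℓ

end GeneratedSets

section Expansions

variable {ι : Type*} [Fintype ι] [DecidableEq ι] {R : Matrix ι ι ℤ} {L : Finset (ι → ℤ)}

/-- The vectors that have integral products with all `R ^ k b`, `b ∈ D`. -/
def integralVectors (R : Matrix ι ι ℤ) (D : Set (ι → ℤ)) : Set (ι → ℝ) :=
  {x | ∀ b ∈ D, ∀ k : ℕ, ∃ z : ℤ, x ⬝ᵥ realVec ((R ^ k).mulVec b) = z}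

/-- `s` has an infinite expansion in base `Rᵀ` with digits in `L`, whose remainders are integral
for `D` and take finitely many values. -/
def HasFiniteExpansion (R : Matrix ι ι ℤ) (L : Finset (ι → ℤ)) (D : Set (ι → ℤ))
    (s : ι → ℝ) : Prop :=
  ∃ u : ℕ → ι → ℝ, u 0 = s ∧ (Set.range u).Finite ∧
    (∀ n, ∃ ℓ ∈ L, u n = (realMat R).transpose.mulVec (u (n + 1)) + realVec ℓ) ∧
    ∀ n, u n ∈ integralVectors R D

theorem mulVec_transpose_dotProduct_realVec (x : ι → ℝ) (k : ℕ) (b : ι → ℤ) :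
    (realMat R).transpose.mulVec x ⬝ᵥ realVec ((R ^ k).mulVec b) =
      x ⬝ᵥ realVec ((R ^ (k + 1)).mulVec b) := by
  rw [Matrix.mulVec_transpose, ← Matrix.dotProduct_mulVec, realMat_mulVec, Matrix.mulVec_mulVec,
    pow_succ']

theorem integral_of_mem_integralVectors {D : Set (ι → ℤ)} {x : ι → ℝ}
    (hx : x ∈ integralVectors R D) {b : ι → ℤ} (hb : b ∈ D) :
    ∃ z : ℤ, x ⬝ᵥ realVec b = z := by
  simpa using hx b hb 0

theorem mulVec_add_mem_integralVectors {D : Set (ι → ℤ)} {x : ι → ℝ}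
    (hx : x ∈ integralVectors R D) (ℓ : ι → ℤ) :
    (realMat R).transpose.mulVec x + realVec ℓ ∈ integralVectors R D := by
  intro b hb k
  obtain ⟨z, hz⟩ := hx b hb (k + 1)
  refine ⟨z + ℓ ⬝ᵥ (R ^ k).mulVec b, ?_⟩
  rw [add_dotProduct, mulVec_transpose_dotProduct_realVec, hz, realVec_dotProduct]
  push_cast
  ring

theorem HasFiniteExpansion.mem_integralVectors {D : Set (ι → ℤ)} {s : ι → ℝ}
    (h : HasFiniteExpansion R L D s) : s ∈ integralVectors R D := by
  obtain ⟨u, rfl, -, -, hu⟩ := h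
  exact hu 0

theorem HasFiniteExpansion.mulVec_add {D : Set (ι → ℤ)} {s : ι → ℝ}
    (h : HasFiniteExpansion R L D s) {ℓ : ι → ℤ} (hℓ : ℓ ∈ L) :
    HasFiniteExpansion R L D ((realMat R).transpose.mulVec s + realVec ℓ) := by
  have hs := h.mem_integralVectors
  obtain ⟨u, rfl, hfin, hu, hint⟩ := h
  set s' := (realMat R).transpose.mulVec (u 0) + realVec ℓ with hs'
  refine ⟨fun n => Nat.casesOn n s' u, rfl, ?_, ?_, ?_⟩
  · refine (hfin.insert s').subset ?_
    rintro _ ⟨n, rfl⟩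
    cases n with
    | zero => exact Set.mem_insert _ _
    | succ n => exact Set.mem_insert_of_mem _ ⟨n, rfl⟩
  · intro n
    cases n with
    | zero => exact ⟨ℓ, hℓ, hs'⟩
    | succ n => exact hu n
  · intro n
    cases n with
    | zero => exact mulVec_add_mem_integralVectors hs ℓ
    | succ n => exact hint n

theorem IsCycle.finite {C : Set (ι → ℝ)} (h : IsCycle R L C) : C.Finite := by
  obtain ⟨m, -, ℓ, x, -, -, rfl⟩ := h
  exact (Set.finite_Iio m).image x

theorem IsCycle.nonempty {C : Set (ι → ℝ)} (h : IsCycle R L C) : C.Nonempty := by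
  obtain ⟨m, hm, ℓ, x, -, -, rfl⟩ := h
  exact ⟨x 0, 0, hm, rfl⟩

theorem IsCycle.exists_pred {C : Set (ι → ℝ)} (h : IsCycle R L C) {c : ι → ℝ} (hc : c ∈ C) :
    ∃ c' ∈ C, ∃ ℓ ∈ L, c = tau R ℓ c' := by
  obtain ⟨m, hm, ℓ, x, hx, hxm, rfl⟩ := h
  obtain ⟨k, hk, rfl⟩ := hc
  cases k with
  | zero =>
    have h1 : m - 1 < m := by omega
    refine ⟨x (m - 1), ⟨m - 1, h1, rfl⟩, ℓ (m - 1), (hx _ h1).1, ?_⟩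
    rw [← (hx _ h1).2, Nat.sub_add_cancel hm, hxm]
  | succ k =>
    have h1 : k < m := by
      have : k + 1 < m := hk
      omega
    exact ⟨x k, ⟨k, h1, rfl⟩, ℓ k, (hx k h1).1, (hx k h1).2⟩

theorem IsCycle.exists_succ {C : Set (ι → ℝ)} (h : IsCycle R L C) {c : ι → ℝ} (hc : c ∈ C) :
    ∃ c' ∈ C, ∃ ℓ ∈ L, c' = tau R ℓ c := by
  obtain ⟨m, hm, ℓ, x, hx, hxm, rfl⟩ := h
  obtain ⟨k, hk, rfl⟩ := hc
  have hk' : k < m := hk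
  refine ⟨x (k + 1), ?_, ℓ k, (hx k hk').1, (hx k hk').2⟩
  rcases (Nat.succ_le_of_lt hk').eq_or_lt with h1 | h1
  · exact ⟨0, hm, by rw [← hxm, ← h1]⟩
  · exact ⟨k + 1, h1, rfl⟩

theorem IsCycle.subset_integralVectors (hR : IsExpansive R) {C : Set (ι → ℝ)}
    (h : IsCycle R L C) {D : Set (ι → ℤ)}
    (hD : ∀ c ∈ C, ∀ b ∈ D, ∃ z : ℤ, c ⬝ᵥ realVec b = z) : C ⊆ integralVectors R D := by
  intro c hc b hb k
  induction k generalizing c with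
  | zero => simpa using hD c hc b hb
  | succ k ih =>
    obtain ⟨c', hc', ℓ, -, rfl⟩ := h.exists_pred hc
    obtain ⟨z, hz⟩ := ih hc'
    refine ⟨z + ℓ ⬝ᵥ (R ^ k).mulVec b, ?_⟩
    rw [← mulVec_transpose_dotProduct_realVec, tau_eq, hR.mulVec_dualInv, add_dotProduct, hz,
      realVec_dotProduct]
    push_cast
    ring

theorem IsCycle.hasFiniteExpansion_neg (hR : IsExpansive R) {C : Set (ι → ℝ)}
    (h : IsCycle R L C) {D : Set (ι → ℤ)}
    (hD : ∀ c ∈ C, ∀ b ∈ D, ∃ z : ℤ, c ⬝ᵥ realVec b = z) {c : ι → ℝ} (hc : c ∈ C) :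
    HasFiniteExpansion R L D (-c) := by
  choose! f hfC ℓ hℓ hf using fun c hc => h.exists_succ (c := c) hc
  have hmem : ∀ n, f^[n] c ∈ C := by
    intro n
    induction n with
    | zero => exact hc
    | succ n ih => rw [Function.iterate_succ_apply']; exact hfC _ ih
  refine ⟨fun n => -(f^[n] c), rfl, ?_, fun n => ?_, fun n b hb k => ?_⟩
  · refine (h.finite.image fun c => -c).subset ?_
    rintro _ ⟨n, rfl⟩
    exact ⟨_, hmem n, rfl⟩
  · refine ⟨ℓ (f^[n] c), hℓ _ (hmem n), ?_⟩
    change -f^[n] c = (realMat R).transpose.mulVec (-f^[n + 1] c) + _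
    rw [Function.iterate_succ_apply', hf _ (hmem n), tau_eq, Matrix.mulVec_neg,
      hR.mulVec_dualInv]
    abel
  · obtain ⟨z, hz⟩ := h.subset_integralVectors hR hD (hmem n) b hb k
    exact ⟨-z, by rw [neg_dotProduct, hz]; push_cast; rfl⟩

theorem hasFiniteExpansion_of_mem_generatedSet (hR : IsExpansive R) {D : Set (ι → ℤ)}
    {𝒞 : Set (Set (ι → ℝ))} (h𝒞 : ∀ C ∈ 𝒞, IsCycle R L C)
    (hD : ∀ C ∈ 𝒞, ∀ c ∈ C, ∀ b ∈ D, ∃ z : ℤ, c ⬝ᵥ realVec b = z) {s : ι → ℝ}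
    (hs : s ∈ generatedSet R L (⋃₀ 𝒞)) : HasFiniteExpansion R L D s := by
  refine hs {s | HasFiniteExpansion R L D s} ⟨?_, fun s hs ℓ hℓ => hs.mulVec_add hℓ⟩
  rintro c ⟨C, hC, hc⟩
  exact (h𝒞 C hC).hasFiniteExpansion_neg hR (hD C hC) hc

theorem IsExpansive.dualInv_pow_mulVec_injective (hR : IsExpansive R) (n : ℕ) :
    Function.Injective (dualInv R ^ n).mulVec := by
  refine Matrix.mulVec_injective_of_isUnit (IsUnit.pow _ ?_)
  rw [dualInv, Matrix.isUnit_nonsing_inv_iff, Matrix.isUnit_iff_isUnit_det, Matrix.det_transpose]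
  exact hR.isUnit_det

/-- Distinct frequencies with finite expansions are separated by one of the masks. -/
theorem HasFiniteExpansion.exists_mask_eq_zero {D : ℕ → Finset (ι → ℤ)}
    (hD : ∀ n, IsHadamardTriple R (D n) L) {E : Set (ι → ℤ)} (hDE : ∀ n, ∀ b ∈ D n, b ∈ E)
    {s t : ι → ℝ} (hs : HasFiniteExpansion R L E s) (ht : HasFiniteExpansion R L E t)
    (hst : s ≠ t) : ∃ k, mask (D k) ((dualInv R ^ (k + 1)).mulVec (s - t)) = 0 := by
  have hR := (hD 0).expansive
  obtain ⟨u, rfl, hufin, hu, huint⟩ := hs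
  obtain ⟨v, rfl, hvfin, hv, hvint⟩ := ht
  choose p hp hup using hu
  choose q hq hvq using hv
  have hstep : ∀ n, (dualInv R).mulVec (u n - v n) =
      (u (n + 1) - v (n + 1)) + (dualInv R).mulVec (realVec (p n) - realVec (q n)) := by
    intro n
    conv_lhs => rw [hup n, hvq n]
    rw [add_sub_add_comm, ← Matrix.mulVec_sub, Matrix.mulVec_add, hR.dualInv_mulVec]
  have hdiff : ∀ n, (∀ k < n, p k = q k) → (dualInv R ^ n).mulVec (u 0 - v 0) = u n - v n := by
    intro n
    induction n with
    | zero => intro _; simp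
    | succ n ih =>
      intro hk
      rw [pow_succ', ← Matrix.mulVec_mulVec, ih fun k hkn => hk k (by omega), hstep,
        hk n (by omega), sub_self, Matrix.mulVec_zero, add_zero]
  by_cases hall : ∀ n, p n = q n
  · exfalso
    have hF : (Set.image2 (fun a b => a - b) (Set.range u) (Set.range v) \ {0}).Finite :=
      (hufin.image2 _ hvfin).subset Set.sdiff_subset
    have hev := (hR.tendsto_dualInv_pow_mulVec (u 0 - v 0)).eventually
      (hF.isClosed.isOpen_compl.mem_nhds (by simp))
    obtain ⟨n, hn⟩ := hev.exists
    rw [hdiff n fun k _ => hall k] at hn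
    have h0 : u n - v n = 0 := by
      by_contra hne
      exact hn ⟨Set.mem_image2_of_mem ⟨n, rfl⟩ ⟨n, rfl⟩, hne⟩
    rw [← hdiff n fun k _ => hall k] at h0
    have := hR.dualInv_pow_mulVec_injective n (h0.trans (Matrix.mulVec_zero _).symm)
    exact hst (sub_eq_zero.1 this)
  · classical
    push Not at hall
    have hmin : ∀ k < Nat.find hall, p k = q k := fun k hk => by
      simpa using Nat.find_min hall hk
    have hne := Nat.find_spec hall
    generalize Nat.find hall = n at hmin hne
    refine ⟨n, ?_⟩
    rw [pow_succ', ← Matrix.mulVec_mulVec, hdiff n hmin, hstep, add_comm,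
      mask_add_of_integral, (hD n).mask_dualInv_sub (hp n) (hq n) hne]
    intro b hb
    obtain ⟨z, hz⟩ := integral_of_mem_integralVectors (huint (n + 1)) (hDE n b hb)
    obtain ⟨w, hw⟩ := integral_of_mem_integralVectors (hvint (n + 1)) (hDE n b hb)
    exact ⟨z - w, by rw [sub_dotProduct, hz, hw]; push_cast; rfl⟩

end Expansions

section InvariantSets

variable {ι : Type*} [Fintype ι] [DecidableEq ι] {R : Matrix ι ι ℤ} {B L : Finset (ι → ℤ)}

theorem continuous_tau (ℓ : ι → ℤ) : Continuous (tau R ℓ) := by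
  simp only [funext (tau_eq (R := R) ℓ)]
  exact Continuous.matrix_mulVec continuous_const (continuous_id.add continuous_const)

/-- Every point lies in a compact set that is mapped into itself by all `τ_ℓ`. -/
theorem IsExpansive.exists_isCompact_tau_mem (hR : IsExpansive R) (hL : L.Nonempty) (x : ι → ℝ) :
    ∃ X : Set (ι → ℝ), IsCompact X ∧ x ∈ X ∧ ∀ y ∈ X, ∀ ℓ ∈ L, tau R ℓ y ∈ X := by
  obtain ⟨C, ρ, hC, hρ0, hρ1, hb⟩ := hR.exists_norm_dualInv_pow_mulVec_le
  obtain ⟨ℓ₀, hℓ₀⟩ := hL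
  set c : ℝ := ∑ ℓ ∈ L, ‖realVec ℓ‖ with hc
  have hcL : ∀ ℓ ∈ L, ‖realVec ℓ‖ ≤ c := fun ℓ hℓ =>
    Finset.single_le_sum (f := fun ℓ => ‖realVec ℓ‖) (fun _ _ => norm_nonneg _) hℓ
  have hc0 : 0 ≤ c := Finset.sum_nonneg fun _ _ => norm_nonneg _
  set Y : Set (ι → ℝ) := {y | ∃ (n : ℕ) (w : ℕ → ι → ℤ), (∀ k, w k ∈ L) ∧
    y = (dualInv R ^ n).mulVec x +
      ∑ k ∈ Finset.range n, (dualInv R ^ (k + 1)).mulVec (realVec (w k))} with hY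
  have hsum : Summable fun k : ℕ => C * ρ ^ (k + 1) * c :=
    (((summable_geometric_of_lt_one hρ0.le hρ1).comp_injective
      (add_left_injective 1)).mul_left C).mul_right c
  have hbdd : Bornology.IsBounded Y := by
    rw [isBounded_iff_forall_norm_le]
    refine ⟨C * ‖x‖ + ∑' k : ℕ, C * ρ ^ (k + 1) * c, ?_⟩
    rintro y ⟨n, w, hw, rfl⟩
    refine (norm_add_le _ _).trans (add_le_add ?_ ?_)
    · refine (hb n x).trans ?_
      have := pow_le_one₀ hρ0.le hρ1.le (n := n)
      gcongr
      nlinarith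
    · refine (norm_sum_le _ _).trans ((Finset.sum_le_sum fun k _ => ?_).trans
        (hsum.sum_le_tsum (Finset.range n) fun k _ => by positivity))
      refine (hb (k + 1) _).trans ?_
      gcongr
      exact hcL _ (hw k)
  have hmaps : ∀ ℓ ∈ L, Set.MapsTo (tau R ℓ) Y Y := by
    rintro ℓ hℓ y ⟨n, w, hw, rfl⟩
    refine ⟨n + 1, fun k => Nat.casesOn k ℓ w, fun k => ?_, ?_⟩
    · cases k with
      | zero => exact hℓ
      | succ k => exact hw k
    · rw [Finset.sum_range_succ', tau_eq, Matrix.mulVec_add, Matrix.mulVec_add, Matrix.mulVec_mulVec,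
        ← pow_succ', Matrix.mulVec_sum, add_assoc]
      congr 2
      · refine Finset.sum_congr rfl fun k _ => ?_
        rw [Matrix.mulVec_mulVec, ← pow_succ']
      · simp
  refine ⟨closure Y, Metric.isCompact_of_isClosed_isBounded isClosed_closure hbdd.closure,
    subset_closure ⟨0, fun _ => ℓ₀, fun _ => hℓ₀, by simp⟩, fun y hy ℓ hℓ => ?_⟩
  exact map_mem_closure (continuous_tau ℓ) hy (hmaps ℓ hℓ)

theorem exists_isMinimalCompactInvariant_subset {K : Set (ι → ℝ)} (hne : K.Nonempty)
    (hK : IsCompact K) (hinv : IsInvariant R B L K) :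
    ∃ M ⊆ K, IsMinimalCompactInvariant R B L M := by
  refine zorn_superset_nonempty
    {S : Set (ι → ℝ) | S.Nonempty ∧ IsCompact S ∧ IsInvariant R B L S} ?_ K ⟨hne, hK, hinv⟩
  intro c hc hchain hcne
  have : Nonempty c := hcne.to_subtype
  refine ⟨⋂₀ c, ⟨?_, ?_, ?_⟩, fun s hs => Set.sInter_subset_of_mem hs⟩
  · exact IsCompact.nonempty_sInter_of_directed_nonempty_isCompact_isClosed
      (fun s hs t ht => (hchain.total hs ht).elim (fun h => ⟨s, hs, le_rfl, h⟩)
        fun h => ⟨t, ht, h, le_rfl⟩) (fun s hs => (hc hs).1) (fun s hs => (hc hs).2.1)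
      fun s hs => (hc hs).2.1.isClosed
  · obtain ⟨s, hs⟩ := hcne
    exact (hc hs).2.1.of_isClosed_subset
      (isClosed_sInter fun s hs => (hc hs).2.1.isClosed) (Set.sInter_subset_of_mem hs)
  · intro x hx ℓ hℓ hpos s hs
    exact (hc hs).2.2 x (hx s hs) ℓ hℓ hpos

theorem IsHadamardTriple.sum_enorm_mask_tau (h : IsHadamardTriple R B L) (x : ι → ℝ) :
    ∑ ℓ ∈ L, ‖mask B (tau R ℓ x)‖ₑ ^ 2 = 1 := by
  have h1 : ∀ ℓ, ‖mask B (tau R ℓ x)‖ₑ ^ 2 = ENNReal.ofReal (‖mask B (tau R ℓ x)‖ ^ 2) := by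
    intro ℓ
    rw [ENNReal.ofReal_pow (norm_nonneg _), ofReal_norm]
  rw [Finset.sum_congr rfl fun ℓ _ => h1 ℓ,
    ← ENNReal.ofReal_sum_of_nonneg fun _ _ => by positivity, h.sum_norm_mask_tau, ENNReal.ofReal_one]

/-- The sum `∑ |φ(x + s)|²` over a set with `Rᵀ Λ + L ⊆ Λ` dominates its transfer. -/
theorem IsHadamardTriple.sum_mul_tsum_le (h : IsHadamardTriple R B L) {φ : (ι → ℝ) → ℂ}
    (hφ : ∀ x, φ x = mask B ((dualInv R).mulVec x) * φ ((dualInv R).mulVec x)) {Λ : Set (ι → ℝ)}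
    (hΛ : ∀ s ∈ Λ, ∀ ℓ ∈ L, (realMat R).transpose.mulVec s + realVec ℓ ∈ Λ)
    (hint : ∀ s ∈ Λ, ∀ b ∈ B, ∃ z : ℤ, s ⬝ᵥ realVec b = z) (x : ι → ℝ) :
    ∑ ℓ ∈ L, ‖mask B (tau R ℓ x)‖ₑ ^ 2 * ∑' s : Λ, ‖φ (tau R ℓ x + s)‖ₑ ^ 2 ≤
      ∑' s : Λ, ‖φ (x + s)‖ₑ ^ 2 := by
  have hR := h.expansive
  have hterm : ∀ (ℓ : ι → ℤ) (s : Λ), ‖mask B (tau R ℓ x)‖ₑ ^ 2 * ‖φ (tau R ℓ x + s)‖ₑ ^ 2 =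
      ‖φ (x + ((realMat R).transpose.mulVec s.1 + realVec ℓ))‖ₑ ^ 2 := by
    intro ℓ s
    have h1 : (dualInv R).mulVec (x + ((realMat R).transpose.mulVec s.1 + realVec ℓ)) =
        tau R ℓ x + s := by
      rw [add_left_comm, Matrix.mulVec_add, hR.dualInv_mulVec, tau_eq, add_comm]
    rw [hφ (x + _), h1, mask_add_of_integral (hint s s.2), enorm_mul, mul_pow]
  let e : L × Λ → Λ := fun p =>
    ⟨(realMat R).transpose.mulVec p.2.1 + realVec p.1.1, hΛ _ p.2.2 _ p.1.2⟩
  have he : Function.Injective e := by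
    rintro ⟨⟨ℓ, hℓ⟩, ⟨s, hs⟩⟩ ⟨⟨ℓ', hℓ'⟩, ⟨s', hs'⟩⟩ heq
    have h1 : (realMat R).transpose.mulVec s + realVec ℓ =
      (realMat R).transpose.mulVec s' + realVec ℓ' := congr_arg Subtype.val heq
    have h2 : (dualInv R).mulVec (realVec ℓ - realVec ℓ') = s' - s := by
      have h3 : realVec ℓ - realVec ℓ' = (realMat R).transpose.mulVec (s' - s) := by
        rw [Matrix.mulVec_sub, sub_eq_sub_iff_add_eq_add, add_comm, h1]
      rw [h3, hR.dualInv_mulVec]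
    have hℓℓ : ℓ = ℓ' := by
      by_contra hne
      have h4 := h.mask_dualInv_sub hℓ hℓ' hne
      have h5 := norm_mask_eq_one_of_integral h.nonempty_B (x := s' - s) fun b hb => by
        obtain ⟨z, hz⟩ := hint s hs b hb
        obtain ⟨w, hw⟩ := hint s' hs' b hb
        exact ⟨w - z, by rw [sub_dotProduct, hz, hw]; push_cast; rfl⟩
      rw [h2] at h4
      simp [h4] at h5
    subst hℓℓ
    rw [sub_self, Matrix.mulVec_zero] at h2
    have h6 : s = s' := (sub_eq_zero.1 h2.symm).symm
    subst h6
    rfl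
  calc ∑ ℓ ∈ L, ‖mask B (tau R ℓ x)‖ₑ ^ 2 * ∑' s : Λ, ‖φ (tau R ℓ x + s)‖ₑ ^ 2
      = ∑ ℓ : L, ∑' s : Λ, ‖φ (x + e (ℓ, s))‖ₑ ^ 2 := by
        rw [← Finset.sum_coe_sort]
        refine Finset.sum_congr rfl fun ℓ _ => ?_
        rw [← ENNReal.tsum_mul_left]
        exact tsum_congr fun s => hterm ℓ.1 s
    _ = ∑' p : L × Λ, ‖φ (x + e p)‖ₑ ^ 2 := by
        rw [ENNReal.tsum_prod (f := fun ℓ s => ‖φ (x + e (ℓ, s))‖ₑ ^ 2), tsum_fintype]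
    _ ≤ _ := ENNReal.tsum_comp_le_tsum_of_injective he fun s : Λ => ‖φ (x + s)‖ₑ ^ 2

/-- For a dynamically simple triple, the sum `∑ |φ(x + s)|²` over a set that contains the set
generated by the extreme cycles is at least one. -/
theorem IsHadamardTriple.one_le_tsum (h : IsHadamardTriple R B L)
    (hsimple : IsDynamicallySimple R B L) {φ : (ι → ℝ) → ℂ} (hφc : Continuous φ) (hφ0 : φ 0 = 1)
    (hφ : ∀ x, φ x = mask B ((dualInv R).mulVec x) * φ ((dualInv R).mulVec x)) {Λ : Set (ι → ℝ)}
    (hcyc : ∀ C, IsExtremeCycle R B L C → ∀ c ∈ C, -c ∈ Λ)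
    (hΛ : ∀ s ∈ Λ, ∀ ℓ ∈ L, (realMat R).transpose.mulVec s + realVec ℓ ∈ Λ)
    (hint : ∀ s ∈ Λ, ∀ b ∈ B, ∃ z : ℤ, s ⬝ᵥ realVec b = z) (x : ι → ℝ) :
    1 ≤ ∑' s : Λ, ‖φ (x + s)‖ₑ ^ 2 := by
  set H : (ι → ℝ) → ENNReal := fun x => ∑' s : Λ, ‖φ (x + s)‖ₑ ^ 2 with hH
  have hlsc : LowerSemicontinuous H := lowerSemicontinuous_tsum fun s =>
    Continuous.lowerSemicontinuous (by fun_prop)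
  obtain ⟨X, hX, hxX, hXtau⟩ := h.expansive.exists_isCompact_tau_mem ⟨0, h.zero_mem_L⟩ x
  obtain ⟨y₀, hy₀, hmin⟩ := LowerSemicontinuousOn.exists_isMinOn ⟨x, hxX⟩ hX
    (hlsc.lowerSemicontinuousOn X)
  rw [isMinOn_iff] at hmin
  by_contra! hlt
  have hm1 : H y₀ < 1 := (hmin x hxX).trans_lt hlt
  have hmtop : H y₀ ≠ ⊤ := hm1.ne_top
  have hKinv : IsInvariant R B L (X ∩ H ⁻¹' Set.Iic (H y₀)) := by
    rintro y ⟨hyX, hyH⟩ ℓ hℓ hpos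
    refine ⟨hXtau y hyX ℓ hℓ, ?_⟩
    by_contra hgt
    have hgt' : H y₀ < H (tau R ℓ y) := by simpa using hgt
    have hw0 : ‖mask B (tau R ℓ y)‖ₑ ^ 2 ≠ 0 := by
      simpa using norm_pos_iff.1 hpos
    have hwtop : ‖mask B (tau R ℓ y)‖ₑ ^ 2 ≠ ⊤ := by simp
    have h1 : ∑ k ∈ L, ‖mask B (tau R k y)‖ₑ ^ 2 * H y₀ <
        ∑ k ∈ L, ‖mask B (tau R k y)‖ₑ ^ 2 * H (tau R k y) := by
      rw [← Finset.add_sum_erase L _ hℓ, ← Finset.add_sum_erase L _ hℓ]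
      refine ENNReal.add_lt_add_of_lt_of_le ?_ ?_ ?_
      · exact ENNReal.sum_ne_top.2 fun k _ => ENNReal.mul_ne_top (by simp) hmtop
      · exact (ENNReal.mul_lt_mul_iff_right hw0 hwtop).2 hgt'
      · refine Finset.sum_le_sum fun k hk => ?_
        gcongr
        exact hmin _ (hXtau y hyX k (Finset.mem_of_mem_erase hk))
    rw [← Finset.sum_mul, h.sum_enorm_mask_tau, one_mul] at h1
    exact absurd (h1.trans_le ((h.sum_mul_tsum_le hφ hΛ hint y).trans hyH)) (lt_irrefl _)
  obtain ⟨M, hMK, hM⟩ := exists_isMinimalCompactInvariant_subset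
    (K := X ∩ H ⁻¹' Set.Iic (H y₀)) ⟨y₀, hy₀, le_refl (H y₀)⟩
    (hX.inter_right (hlsc.isClosed_preimage (H y₀))) hKinv
  have hext := hsimple M hM
  obtain ⟨c, hc⟩ := hext.1.nonempty
  have h2 : (1 : ENNReal) ≤ H c := by
    refine le_trans ?_ (ENNReal.le_tsum (⟨-c, hcyc M hext c hc⟩ : Λ))
    simp [hφ0]
  exact absurd ((h2.trans (hMK hc).2).trans_lt hm1) (lt_irrefl _)

end InvariantSets

section Bessel

variable {H κ : Type*} [NormedAddCommGroup H] [InnerProductSpace ℂ H] {v : κ → H}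

theorem tsum_enorm_inner_sq_le (hv : Orthonormal ℂ v) (x : H) :
    ∑' i, ‖inner ℂ (v i) x‖ₑ ^ 2 ≤ ‖x‖ₑ ^ 2 := by
  rw [ENNReal.tsum_eq_iSup_sum]
  refine iSup_le fun s => ?_
  have h := ENNReal.ofReal_le_ofReal (hv.sum_inner_products_le x (s := s))
  rw [ENNReal.ofReal_sum_of_nonneg fun _ _ => by positivity] at h
  simpa only [ENNReal.ofReal_pow (norm_nonneg _), ofReal_norm] using h

/-- A vector for which Bessel's inequality is an equality lies in the closed span. -/
theorem mem_topologicalClosure_span_of_le_tsum [CompleteSpace H] (hv : Orthonormal ℂ v) {x : H}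
    (hx : ‖x‖ₑ ^ 2 ≤ ∑' i, ‖inner ℂ (v i) x‖ₑ ^ 2) :
    x ∈ (Submodule.span ℂ (Set.range v)).topologicalClosure := by
  set K := (Submodule.span ℂ (Set.range v)).topologicalClosure with hK
  have : CompleteSpace K := (Submodule.isClosed_topologicalClosure _).completeSpace_coe
  have hvK : ∀ i, v i ∈ K := fun i =>
    Submodule.le_topologicalClosure _ (Submodule.subset_span ⟨i, rfl⟩)
  have hin : ∀ i, inner ℂ (v i) x = inner ℂ (v i) (K.starProjection x) := by
    intro i
    have h1 := K.sub_starProjection_mem_orthogonal x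
    have h2 := (Submodule.mem_orthogonal _ _).1 h1 (v i) (hvK i)
    rwa [inner_sub_right, sub_eq_zero] at h2
  have hle : ‖x‖ₑ ^ 2 ≤ ‖K.starProjection x‖ₑ ^ 2 := by
    refine hx.trans ?_
    simp only [hin]
    exact tsum_enorm_inner_sq_le hv _
  have hle' : ‖x‖ ≤ ‖K.starProjection x‖ := by
    have h1 : ‖x‖ₑ ≤ ‖K.starProjection x‖ₑ := (ENNReal.pow_le_pow_left_iff two_ne_zero).1 hle
    exact enorm_le_iff_norm_le.1 h1
  have hpyth := Submodule.norm_sq_eq_add_norm_sq_starProjection x K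
  have hz : ‖Kᗮ.starProjection x‖ = 0 := by
    have h1 : ‖x‖ ^ 2 ≤ ‖K.starProjection x‖ ^ 2 := by gcongr
    have h2 : ‖Kᗮ.starProjection x‖ ^ 2 ≤ 0 := by linarith
    exact pow_eq_zero_iff two_ne_zero |>.1 (le_antisymm h2 (sq_nonneg _))
  have h3 := K.starProjection_add_starProjection_orthogonal x
  rw [norm_eq_zero.1 hz, add_zero] at h3
  rw [← h3]
  exact K.starProjection_apply_mem x

theorem Orthonormal.countable_index [SecondCountableTopology H] (hv : Orthonormal ℂ v) :
    Countable κ := by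
  refine Pairwise.countable_of_isOpen_disjoint (s := fun i => Metric.ball (v i) (1 / 2)) ?_
    (fun i => Metric.isOpen_ball) fun i => ⟨v i, Metric.mem_ball_self (by norm_num)⟩
  intro i j hij
  refine Metric.ball_disjoint_ball ?_
  have h1 : ‖v i - v j‖ ^ 2 = 2 := by
    rw [@norm_sub_sq ℂ, hv.1 i, hv.1 j, hv.2 hij]
    norm_num
  rw [dist_eq_norm]
  nlinarith [norm_nonneg (v i - v j)]

end Bessel

section Density

variable {ι : Type*} [Fintype ι]

/-- An integrable real function all of whose Fourier coefficients vanish is zero. -/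
theorem ae_eq_zero_of_integral_expFun_mul_eq_zero {μ : Measure (ι → ℝ)} [IsFiniteMeasure μ]
    {g : (ι → ℝ) → ℝ} (hg : Integrable g μ) (h : ∀ ξ, ∫ x, expFun ξ x * (g x : ℂ) ∂μ = 0) :
    g =ᵐ[μ] 0 := by
  classical
  have hfin : ∀ f : (ι → ℝ) → ℝ, Integrable f μ →
      IsFiniteMeasure (μ.withDensity fun x => ENNReal.ofReal (f x)) := fun f hf =>
    isFiniteMeasure_withDensity_ofReal hf.2
  have hint : ∀ f : (ι → ℝ) → ℝ, Integrable f μ → ∀ ξ,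
      ∫ x, expFun ξ x ∂(μ.withDensity fun x => ENNReal.ofReal (f x)) =
        ∫ x, ((max (f x) 0 : ℝ) : ℂ) * expFun ξ x ∂μ := by
    intro f hf ξ
    rw [integral_withDensity_eq_integral_toReal_smul₀ hf.aemeasurable.ennreal_ofReal
      (Eventually.of_forall fun x => ENNReal.ofReal_lt_top)]
    simp only [ENNReal.toReal_ofReal', Complex.real_smul]
  have hmax : ∀ f : (ι → ℝ) → ℝ, Integrable f μ → ∀ ξ,
      Integrable (fun x => ((max (f x) 0 : ℝ) : ℂ) * expFun ξ x) μ := by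
    intro f hf ξ
    refine Integrable.mul_bdd (c := 1) (hf.pos_part.ofReal)
      (continuous_expFun ξ).aestronglyMeasurable
      (Eventually.of_forall fun x => (norm_expFun ξ x).le)
  have := hfin g hg
  have := hfin _ hg.neg
  have heq : (μ.withDensity fun x => ENNReal.ofReal (g x)) =
      μ.withDensity fun x => ENNReal.ofReal ((-g) x) := by
    refine Measure.ext_of_charFunDual (funext fun ℓ => ?_)
    set ξ : ι → ℝ := fun i => ℓ (Pi.single i 1) / (2 * Real.pi) with hξ
    have hℓ : ∀ x, Complex.exp ((ℓ x : ℂ) * Complex.I) = expFun ξ x := by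
      intro x
      rw [expFun_eq]
      congr 3
      have h1 : ℓ x = ∑ i, x i * ℓ (Pi.single i 1) := by
        conv_lhs => rw [pi_eq_sum_univ' x]
        simp
      rw [h1, dotProduct, Finset.mul_sum]
      refine Finset.sum_congr rfl fun i _ => ?_
      have := Real.pi_ne_zero
      rw [hξ]
      field_simp
    simp only [charFunDual_apply, hℓ]
    rw [hint g hg, hint _ hg.neg, ← sub_eq_zero, ← integral_sub (hmax g hg ξ) (hmax _ hg.neg ξ),
      ← h ξ]
    refine integral_congr_ae (Eventually.of_forall fun x => ?_)
    change _ - ((max (-g x) 0 : ℝ) : ℂ) * _ = _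
    have h2 : max (g x) 0 - max (-g x) 0 = g x := by
      rcases le_total (g x) 0 with h | h
      · rw [max_eq_right h, max_eq_left (by linarith)]; ring
      · rw [max_eq_left h, max_eq_right (by linarith)]; ring
    rw [← sub_mul, ← Complex.ofReal_sub, h2, mul_comm]
  rw [withDensity_eq_iff_of_sigmaFinite hg.aemeasurable.ennreal_ofReal
    hg.neg.aemeasurable.ennreal_ofReal] at heq
  filter_upwards [heq] with x hx
  have h1 := congr_arg ENNReal.toReal hx
  simp only [ENNReal.toReal_ofReal', Pi.neg_apply] at h1
  rcases le_total (g x) 0 with h | h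
  · rw [max_eq_right h, max_eq_left (by linarith)] at h1
    simp only [Pi.zero_apply]; linarith
  · rw [max_eq_left h, max_eq_right (by linarith)] at h1
    simp only [Pi.zero_apply]; linarith

theorem inner_expLp {μ : Measure (ι → ℝ)} [IsFiniteMeasure μ] (ξ : ι → ℝ) (f : Lp ℂ 2 μ) :
    inner ℂ (expLp μ ξ) f = ∫ x, expFun (-ξ) x * f x ∂μ := by
  rw [L2.inner_def]
  refine integral_congr_ae ?_
  filter_upwards [(memLp_expFun μ ξ).coeFn_toLp] with x hx
  rw [expLp, hx, RCLike.inner_apply, conj_expFun, mul_comm]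

theorem inner_expLp_expLp {μ : Measure (ι → ℝ)} [IsFiniteMeasure μ] (ξ η : ι → ℝ) :
    inner ℂ (expLp μ ξ) (expLp μ η) = ∫ x, expFun (η - ξ) x ∂μ := by
  rw [inner_expLp]
  refine integral_congr_ae ?_
  filter_upwards [(memLp_expFun μ η).coeFn_toLp] with x hx
  rw [expLp, hx, sub_eq_neg_add, expFun_add_left]

theorem norm_expLp {μ : Measure (ι → ℝ)} [IsProbabilityMeasure μ] (ξ : ι → ℝ) :
    ‖expLp μ ξ‖ = 1 := by
  have h := inner_self_eq_norm_sq_to_K (𝕜 := ℂ) (expLp μ ξ)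
  rw [inner_expLp_expLp] at h
  simp only [sub_self, expFun_zero_left, integral_const, probReal_univ, one_smul] at h
  have h' : ‖expLp μ ξ‖ ^ 2 = 1 := by
    have h2 : ((1 : ℝ) : ℂ) = ((‖expLp μ ξ‖ ^ 2 : ℝ) : ℂ) := by
      push_cast
      exact h
    exact (Complex.ofReal_injective h2).symm
  exact (pow_eq_one_iff_of_nonneg (norm_nonneg _) two_ne_zero).1 h'

/-- The exponentials whose frequencies form a dense set are total in `L²(μ)`. -/
theorem eq_zero_of_inner_expLp_eq_zero {μ : Measure (ι → ℝ)} [IsFiniteMeasure μ]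
    {S : Set (ι → ℝ)} (hS : Dense S) {f : Lp ℂ 2 μ} (h : ∀ ξ ∈ S, inner ℂ (expLp μ ξ) f = 0) :
    f = 0 := by
  have hf : Integrable f μ := (Lp.memLp f).integrable one_le_two
  have hmul : ∀ ξ, Integrable (fun x => expFun ξ x * f x) μ := fun ξ =>
    hf.bdd_mul (c := 1) (continuous_expFun ξ).aestronglyMeasurable
      (Eventually.of_forall fun x => (norm_expFun ξ x).le)
  have hcont : Continuous fun ξ => ∫ x, expFun (-ξ) x * f x ∂μ := by
    refine continuous_of_dominated (bound := fun x => ‖f x‖) (fun ξ => (hmul (-ξ)).1)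
      (fun ξ => Eventually.of_forall fun x => by simp) hf.norm
      (Eventually.of_forall fun x => ?_)
    exact ((continuous_expFun_left x).comp continuous_neg).mul continuous_const
  have hall : ∀ ξ, ∫ x, expFun (-ξ) x * f x ∂μ = 0 := by
    refine fun ξ => congr_fun (hcont.ext_on hS (continuous_const (y := (0 : ℂ))) fun η hη => ?_) ξ
    exact (inner_expLp η f).symm.trans (h η hη)
  have h1 : ∀ ξ, ∫ x, expFun ξ x * f x ∂μ = 0 := fun ξ => by simpa using hall (-ξ)
  have h2 : ∀ ξ, ∫ x, expFun ξ x * (starRingEnd ℂ) (f x) ∂μ = 0 := by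
    intro ξ
    have h3 := congr_arg (starRingEnd ℂ) (hall ξ)
    rw [← integral_conj, map_zero] at h3
    simpa only [map_mul, conj_expFun, neg_neg] using h3
  have hmul' : ∀ ξ, Integrable (fun x => expFun ξ x * (starRingEnd ℂ) (f x)) μ := by
    intro ξ
    have hc : Integrable (fun x => (starRingEnd ℂ) (f x)) μ :=
      Complex.conjCLE.toContinuousLinearMap.integrable_comp hf
    exact hc.bdd_mul (c := 1) (continuous_expFun ξ).aestronglyMeasurable
      (Eventually.of_forall fun x => (norm_expFun ξ x).le)
  have hre := ae_eq_zero_of_integral_expFun_mul_eq_zero (g := fun x => (f x).re) hf.re fun ξ => by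
    have h3 : ∀ x, expFun ξ x * (((f x).re : ℝ) : ℂ) =
        (1 / 2) * (expFun ξ x * f x + expFun ξ x * (starRingEnd ℂ) (f x)) := by
      intro x
      rw [Complex.re_eq_add_conj]
      ring
    simp only [h3]
    rw [integral_const_mul, integral_add (hmul ξ) (hmul' ξ), h1, h2]
    simp
  have him := ae_eq_zero_of_integral_expFun_mul_eq_zero (g := fun x => (f x).im) hf.im fun ξ => by
    have h3 : ∀ x, expFun ξ x * (((f x).im : ℝ) : ℂ) =
        (1 / (2 * Complex.I)) * (expFun ξ x * f x - expFun ξ x * (starRingEnd ℂ) (f x)) := by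
      intro x
      rw [Complex.im_eq_sub_conj]
      ring
    simp only [h3]
    rw [integral_const_mul, integral_sub (hmul ξ) (hmul' ξ), h1, h2]
    simp
  refine Lp.ext ?_
  filter_upwards [hre, him, Lp.coeFn_zero ℂ 2 μ] with x hx hy hz
  rw [hz]
  exact Complex.ext hx hy

end Density

section Spectra

variable {ι : Type*} [Fintype ι]

/-- The Fourier transform `ξ ↦ ∫ exp (2πi ⟨ξ, x⟩) dμ(x)`. -/
noncomputable def fourierTransform (μ : Measure (ι → ℝ)) (ξ : ι → ℝ) : ℂ := ∫ x, expFun ξ x ∂μ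

theorem continuous_fourierTransform (μ : Measure (ι → ℝ)) [IsFiniteMeasure μ] :
    Continuous (fourierTransform μ) :=
  continuous_of_dominated (bound := fun _ => 1)
    (fun ξ => (continuous_expFun ξ).aestronglyMeasurable)
    (fun ξ => Eventually.of_forall fun x => (norm_expFun ξ x).le) (integrable_const _)
    (Eventually.of_forall fun x => continuous_expFun_left x)

theorem fourierTransform_zero (μ : Measure (ι → ℝ)) [IsProbabilityMeasure μ] :
    fourierTransform μ 0 = 1 := by
  simp [fourierTransform]

theorem fourierTransform_neg (μ : Measure (ι → ℝ)) (ξ : ι → ℝ) :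
    fourierTransform μ (-ξ) = (starRingEnd ℂ) (fourierTransform μ ξ) := by
  rw [fourierTransform, fourierTransform, ← integral_conj]
  simp only [conj_expFun]

theorem enorm_inner_expLp {μ : Measure (ι → ℝ)} [IsFiniteMeasure μ] (s x : ι → ℝ) :
    ‖inner ℂ (expLp μ s) (expLp μ (-x))‖ₑ = ‖fourierTransform μ (x + s)‖ₑ := by
  rw [inner_expLp_expLp]
  change ‖fourierTransform μ (-x - s)‖ₑ = _
  rw [← neg_add', fourierTransform_neg, RCLike.enorm_conj]

theorem orthonormal_expLp {μ : Measure (ι → ℝ)} [IsProbabilityMeasure μ] {Λ : Set (ι → ℝ)}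
    (h : ∀ s ∈ Λ, ∀ t ∈ Λ, s ≠ t → fourierTransform μ (s - t) = 0) :
    Orthonormal ℂ fun ξ : Λ => expLp μ ξ.1 := by
  refine ⟨fun s => norm_expLp s.1, fun s t hst => ?_⟩
  change inner ℂ (expLp μ s.1) (expLp μ t.1) = 0
  rw [inner_expLp_expLp]
  exact h t t.2 s s.2 fun h => hst (Subtype.ext h.symm)

theorem tsum_fourierTransform_le_one {μ : Measure (ι → ℝ)} [IsProbabilityMeasure μ]
    {Λ : Set (ι → ℝ)} (h : Orthonormal ℂ fun ξ : Λ => expLp μ ξ.1) (x : ι → ℝ) :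
    ∑' s : Λ, ‖fourierTransform μ (x + s)‖ₑ ^ 2 ≤ 1 := by
  have := tsum_enorm_inner_sq_le h (expLp μ (-x))
  simp only [enorm_inner_expLp] at this
  refine this.trans ?_
  rw [← ofReal_norm, norm_expLp]
  simp

theorem countable_of_orthonormal_expLp {μ : Measure (ι → ℝ)} [IsFiniteMeasure μ]
    {Λ : Set (ι → ℝ)} (h : Orthonormal ℂ fun ξ : Λ => expLp μ ξ.1) : Λ.Countable := by
  have : Fact ((2 : ENNReal) ≠ ⊤) := ⟨by norm_num⟩
  exact Set.countable_coe_iff.1 (Orthonormal.countable_index h)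

/-- Orthogonal frequencies for which the Parseval sum is at least one on a dense set form a
spectrum. -/
theorem isSpectrum_of_one_le_tsum {μ : ProbabilityMeasure (ι → ℝ)} {Λ S : Set (ι → ℝ)}
    (horth : ∀ s ∈ Λ, ∀ t ∈ Λ, s ≠ t → fourierTransform (μ : Measure (ι → ℝ)) (s - t) = 0)
    (hS : Dense S)
    (hsum : ∀ x ∈ S, 1 ≤ ∑' s : Λ, ‖fourierTransform (μ : Measure (ι → ℝ)) (x + s)‖ₑ ^ 2) :
    IsSpectrum Λ μ := by
  have ho := orthonormal_expLp horth
  refine ⟨countable_of_orthonormal_expLp ho, ho, ?_⟩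
  set K := Submodule.span ℂ (Set.range fun ξ : Λ => expLp (μ : Measure (ι → ℝ)) ξ.1) with hK
  rw [Submodule.topologicalClosure_eq_top_iff, Submodule.eq_bot_iff]
  intro f hf
  rw [← Submodule.orthogonal_closure] at hf
  have hSneg : Dense (-S) := by
    rw [← Set.image_neg_eq_neg]
    exact (Homeomorph.neg (ι → ℝ)).surjective.denseRange.dense_image continuous_neg hS
  refine eq_zero_of_inner_expLp_eq_zero hSneg fun ξ hξ => ?_
  refine (Submodule.mem_orthogonal _ _).1 hf _ (mem_topologicalClosure_span_of_le_tsum ho ?_)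
  have h1 := hsum (-ξ) hξ
  have h2 : ∀ s : Λ, ‖inner ℂ (expLp (μ : Measure (ι → ℝ)) s.1) (expLp (μ : Measure (ι → ℝ)) ξ)‖ₑ =
      ‖fourierTransform (μ : Measure (ι → ℝ)) (-ξ + s)‖ₑ := fun s => by
    rw [← enorm_inner_expLp, neg_neg]
  simp only [h2]
  refine le_trans ?_ h1
  rw [← ofReal_norm, norm_expLp]
  simp

variable [DecidableEq ι] {R : Matrix ι ι ℤ}

theorem IsInfiniteConvolution.fourierTransform_eq_zero (hR : IsExpansive R)
    {D : ℕ → Finset (ι → ℤ)} (hD : ∀ n, (D n).Nonempty) {μ : ProbabilityMeasure (ι → ℝ)}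
    (h : IsInfiniteConvolution R D μ) {ξ : ι → ℝ} {k : ℕ}
    (hk : mask (D k) ((dualInv R ^ (k + 1)).mulVec ξ) = 0) :
    fourierTransform (μ : Measure (ι → ℝ)) ξ = 0 := by
  refine tendsto_nhds_unique (h.tendsto_prod_mask hR hD ξ) (tendsto_const_nhds.congr' ?_)
  filter_upwards [eventually_gt_atTop k] with n hn
  exact (Finset.prod_eq_zero (Finset.mem_range.2 hn) hk).symm

theorem IsInfiniteConvolution.fourierTransform_eq_mask_mul (hR : IsExpansive R)
    {B : Finset (ι → ℤ)} (hB : B.Nonempty) {μ : ProbabilityMeasure (ι → ℝ)}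
    (h : IsInfiniteConvolution R (fun _ => B) μ) (ξ : ι → ℝ) :
    fourierTransform (μ : Measure (ι → ℝ)) ξ = mask B ((dualInv R).mulVec ξ) *
      fourierTransform (μ : Measure (ι → ℝ)) ((dualInv R).mulVec ξ) := by
  have h1 := (h.tendsto_prod_mask hR (fun _ => hB) ξ).comp (tendsto_add_atTop_nat 1)
  have h2 := (h.tendsto_prod_mask hR (fun _ => hB) ((dualInv R).mulVec ξ)).const_mul
    (mask B ((dualInv R).mulVec ξ))
  refine tendsto_nhds_unique h1 (h2.congr fun n => ?_)
  simp only [Function.comp]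
  rw [Finset.prod_range_succ', mul_comm]
  congr 1
  · refine Finset.prod_congr rfl fun k _ => ?_
    rw [Matrix.mulVec_mulVec, ← pow_succ]
  · simp

/-- Frequencies with finite expansions are orthogonal for every infinite convolution. -/
theorem IsInfiniteConvolution.fourierTransform_sub_eq_zero {L : Finset (ι → ℤ)}
    {D : ℕ → Finset (ι → ℤ)} (hD : ∀ n, IsHadamardTriple R (D n) L) {E : Set (ι → ℤ)}
    (hDE : ∀ n, ∀ b ∈ D n, b ∈ E) {μ : ProbabilityMeasure (ι → ℝ)}
    (h : IsInfiniteConvolution R D μ) {Λ : Set (ι → ℝ)}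
    (hΛ : ∀ s ∈ Λ, HasFiniteExpansion R L E s) :
    ∀ s ∈ Λ, ∀ t ∈ Λ, s ≠ t → fourierTransform (μ : Measure (ι → ℝ)) (s - t) = 0 := by
  intro s hs t ht hst
  obtain ⟨k, hk⟩ := (hΛ s hs).exists_mask_eq_zero hD hDE (hΛ t ht) hst
  exact h.fourierTransform_eq_zero (hD 0).expansive (fun n => (hD n).nonempty_B) hk

end Spectra

section SumElim

variable {ι κ : Type*}

theorem elim_inj {α : Type*} {x x' : ι → α} {y y' : κ → α} (h : Sum.elim x y = Sum.elim x' y') :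
    x = x' ∧ y = y' :=
  ⟨congr_arg (· ∘ Sum.inl) h, congr_arg (· ∘ Sum.inr) h⟩

theorem realVec_elim (x : ι → ℤ) (y : κ → ℤ) :
    realVec (Sum.elim x y) = Sum.elim (realVec x) (realVec y) := by
  ext i
  rcases i with i | i <;> rfl

theorem elim_add_elim (x x' : ι → ℝ) (y y' : κ → ℝ) :
    Sum.elim x y + Sum.elim x' y' = Sum.elim (x + x') (y + y') := by
  ext i
  rcases i with i | i <;> rfl

theorem elim_sub_elim (x x' : ι → ℝ) (y y' : κ → ℝ) :
    Sum.elim x y - Sum.elim x' y' = Sum.elim (x - x') (y - y') := by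
  ext i
  rcases i with i | i <;> rfl

variable [Fintype ι] [Fintype κ]

theorem expFun_elim (x x' : ι → ℝ) (y y' : κ → ℝ) :
    expFun (Sum.elim x y) (Sum.elim x' y') = expFun x x' * expFun y y' := by
  rw [expFun, expFun, expFun, ← Complex.exp_add, sumElim_dotProduct_sumElim]
  congr 1
  push_cast
  ring

theorem transpose_fromBlocks_mulVec_elim {R₁ : Matrix ι ι ℤ} {R : Matrix κ κ ℤ} (x : ι → ℝ) (y : κ → ℝ) :
    (realMat (Matrix.fromBlocks R₁ 0 0 R)).transpose.mulVec (Sum.elim x y) =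
      Sum.elim ((realMat R₁).transpose.mulVec x) ((realMat R).transpose.mulVec y) := by
  have h : realMat (Matrix.fromBlocks R₁ 0 0 R) =
      Matrix.fromBlocks (realMat R₁) 0 0 (realMat R) := by
    ext i j
    rcases i with i | i <;> rcases j with j | j <;> simp [realMat]
  rw [h, Matrix.fromBlocks_transpose, Matrix.fromBlocks_mulVec]
  simp

end SumElim

section BlockDiagonal

variable {ι κ : Type*} [Fintype ι] [Fintype κ] [DecidableEq ι] [DecidableEq κ]
  {R₁ : Matrix ι ι ℤ} {R : Matrix κ κ ℤ}

theorem IsHadamardTriple.of_mask_eq_zero {R : Matrix ι ι ℤ} {B L : Finset (ι → ℤ)}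
    (hR : IsExpansive R) (hB : (0 : ι → ℤ) ∈ B) (hL : (0 : ι → ℤ) ∈ L) (hcard : B.card = L.card)
    (h : ∀ ℓ ∈ L, ∀ ℓ' ∈ L, ℓ ≠ ℓ' → mask B ((dualInv R).mulVec (realVec ℓ - realVec ℓ')) = 0) :
    IsHadamardTriple R B L := by
  refine ⟨hR, hB, hL, hcard, (Matrix.mul_eq_one_comm_of_card_eq _ _ _ (by simp [hcard])).1 ?_⟩
  refine Matrix.ext fun ℓ ℓ' => ?_
  rw [hadamardMatrix_mul_conjTranspose_apply]
  by_cases hne : ℓ = ℓ'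
  · rw [hne, Matrix.one_apply_eq, sub_self, Matrix.mulVec_zero, mask_zero ⟨0, hB⟩]
  · rw [Matrix.one_apply_ne hne]
    exact h _ ℓ.2 _ ℓ'.2 fun h => hne (Subtype.ext h)

theorem IsExpansive.fromBlocks (h₁ : IsExpansive R₁) (h : IsExpansive R) :
    IsExpansive (Matrix.fromBlocks R₁ 0 0 R) := by
  intro z hz
  by_contra hle
  have hu₁ : IsUnit (algebraMap ℂ _ z - R₁.map (fun n => (n : ℂ))) := by
    by_contra hn
    exact hle (h₁ z hn)
  have hu : IsUnit (algebraMap ℂ _ z - R.map (fun n => (n : ℂ))) := by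
    by_contra hn
    exact hle (h z hn)
  refine hz ?_
  change IsUnit _
  have he : algebraMap ℂ (Matrix (ι ⊕ κ) (ι ⊕ κ) ℂ) z -
      (Matrix.fromBlocks R₁ 0 0 R).map (fun n => (n : ℂ)) =
      Matrix.fromBlocks (algebraMap ℂ _ z - R₁.map (fun n => (n : ℂ))) 0 0
        (algebraMap ℂ _ z - R.map (fun n => (n : ℂ))) := by
    ext i j
    rcases i with i | i <;> rcases j with j | j <;>
      simp [Matrix.algebraMap_matrix_apply]
  rw [he, Matrix.isUnit_iff_isUnit_det, Matrix.det_fromBlocks_zero₂₁]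
  rw [Matrix.isUnit_iff_isUnit_det] at hu hu₁
  exact hu₁.mul hu

theorem dualInv_fromBlocks_mulVec_elim (h₁ : IsExpansive R₁) (h : IsExpansive R)
    (x : ι → ℝ) (y : κ → ℝ) :
    (dualInv (Matrix.fromBlocks R₁ 0 0 R)).mulVec (Sum.elim x y) =
      Sum.elim ((dualInv R₁).mulVec x) ((dualInv R).mulVec y) := by
  have h2 := (h₁.fromBlocks h).dualInv_mulVec
    (Sum.elim ((dualInv R₁).mulVec x) ((dualInv R).mulVec y))
  rwa [transpose_fromBlocks_mulVec_elim, h₁.mulVec_dualInv, h.mulVec_dualInv] at h2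

theorem dualInv_pow_fromBlocks_mulVec_elim (h₁ : IsExpansive R₁) (h : IsExpansive R) (k : ℕ)
    (x : ι → ℝ) (y : κ → ℝ) :
    (dualInv (Matrix.fromBlocks R₁ 0 0 R) ^ k).mulVec (Sum.elim x y) =
      Sum.elim ((dualInv R₁ ^ k).mulVec x) ((dualInv R ^ k).mulVec y) := by
  induction k with
  | zero => simp
  | succ k ih =>
    rw [pow_succ', pow_succ', pow_succ', ← Matrix.mulVec_mulVec, ih,
      dualInv_fromBlocks_mulVec_elim h₁ h, Matrix.mulVec_mulVec, Matrix.mulVec_mulVec]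

theorem fromBlocks_pow_mulVec_elim (k : ℕ) (x : ι → ℤ) (y : κ → ℤ) :
    ((Matrix.fromBlocks R₁ 0 0 R) ^ k).mulVec (Sum.elim x y) =
      Sum.elim ((R₁ ^ k).mulVec x) ((R ^ k).mulVec y) := by
  induction k with
  | zero => simp
  | succ k ih =>
    rw [pow_succ', pow_succ', pow_succ', ← Matrix.mulVec_mulVec, ih, Matrix.fromBlocks_mulVec,
      ← Matrix.mulVec_mulVec, ← Matrix.mulVec_mulVec]
    simp

theorem tau_fromBlocks_elim (h₁ : IsExpansive R₁) (h : IsExpansive R) (k : ι → ℤ) (ℓ : κ → ℤ)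
    (x : ι → ℝ) (y : κ → ℝ) :
    tau (Matrix.fromBlocks R₁ 0 0 R) (Sum.elim k ℓ) (Sum.elim x y) =
      Sum.elim (tau R₁ k x) (tau R ℓ y) := by
  rw [tau_eq, realVec_elim, elim_add_elim, dualInv_fromBlocks_mulVec_elim h₁ h]
  rfl

end BlockDiagonal

section QuasiProduct

theorem mask_image {r N : ℕ} {a : Fin N → Fin r → ℤ} (ha : Function.Injective a) (x : Fin r → ℝ) :
    mask (Finset.univ.image a) x = (1 / (N : ℂ)) * ∑ i, expFun x (realVec (a i)) := by
  rw [mask_eq, Finset.card_image_of_injective _ ha, Finset.sum_image fun _ _ _ _ h => ha h]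
  simp

variable {r d N : ℕ} [NeZero N]
  {Rq : Matrix (Fin r ⊕ Fin d) (Fin r ⊕ Fin d) ℤ} {Bq Lq : Finset (Fin r ⊕ Fin d → ℤ)}
  {R₁ : Matrix (Fin r) (Fin r) ℤ} {R : Matrix (Fin d) (Fin d) ℤ}
  {a : Fin N → Fin r → ℤ} {B : Fin N → Finset (Fin d → ℤ)}
  {L₁ : Finset (Fin r → ℤ)} {L : Finset (Fin d → ℤ)}

theorem IsQuasiProductForm.sum_eq (h : IsQuasiProductForm Rq Bq Lq R₁ 0 R a B L₁ L)
    {M : Type*} [AddCommMonoid M] (f : (Fin r ⊕ Fin d → ℤ) → M) :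
    ∑ b ∈ Bq, f b = ∑ i, ∑ b ∈ B i, f (Sum.elim (a i) b) := by
  rw [h.B_eq, Finset.sum_biUnion]
  · refine Finset.sum_congr rfl fun i _ => Finset.sum_image fun b _ b' _ hbb => ?_
    exact (elim_inj hbb).2
  · intro i _ j _ hij
    rw [Function.onFun, Finset.disjoint_left]
    intro x hx hx'
    obtain ⟨b, -, rfl⟩ := Finset.mem_image.1 hx
    obtain ⟨b', -, hb'⟩ := Finset.mem_image.1 hx'
    exact hij (h.a_injective (congr_arg (· ∘ Sum.inl) hb')).symm

theorem IsQuasiProductForm.card_eq (h : IsQuasiProductForm Rq Bq Lq R₁ 0 R a B L₁ L) :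
    Bq.card = N * L.card := by
  rw [Finset.card_eq_sum_ones, h.sum_eq]
  simp [fun i => (h.hadamard i).card_eq]

theorem IsQuasiProductForm.mask_elim (h : IsQuasiProductForm Rq Bq Lq R₁ 0 R a B L₁ L)
    (x : Fin r → ℝ) (y : Fin d → ℝ) :
    mask Bq (Sum.elim x y) =
      (1 / (N : ℂ)) * ∑ i, expFun x (realVec (a i)) * mask (B i) y := by
  rw [mask_eq, h.sum_eq, h.card_eq, Finset.mul_sum, Finset.mul_sum]
  refine Finset.sum_congr rfl fun i _ => ?_
  rw [mask_eq, (h.hadamard i).card_eq]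
  simp only [realVec_elim, expFun_elim]
  rw [← Finset.mul_sum]
  push_cast
  ring

theorem IsQuasiProductForm.elim_mem_B (h : IsQuasiProductForm Rq Bq Lq R₁ 0 R a B L₁ L)
    (i : Fin N) {b : Fin d → ℤ} (hb : b ∈ B i) : Sum.elim (a i) b ∈ Bq := by
  rw [h.B_eq]
  exact Finset.mem_biUnion.2 ⟨i, Finset.mem_univ _, Finset.mem_image_of_mem _ hb⟩

theorem IsQuasiProductForm.exists_of_mem_B (h : IsQuasiProductForm Rq Bq Lq R₁ 0 R a B L₁ L)
    {v : Fin r ⊕ Fin d → ℤ} (hv : v ∈ Bq) : ∃ i, ∃ b ∈ B i, Sum.elim (a i) b = v := by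
  rw [h.B_eq] at hv
  simpa using hv

theorem IsQuasiProductForm.elim_mem_L (h : IsQuasiProductForm Rq Bq Lq R₁ 0 R a B L₁ L)
    {k : Fin r → ℤ} (hk : k ∈ L₁) {ℓ : Fin d → ℤ} (hℓ : ℓ ∈ L) : Sum.elim k ℓ ∈ Lq := by
  rw [h.L_eq]
  exact Finset.mem_image.2 ⟨(k, ℓ), Finset.mem_product.2 ⟨hk, hℓ⟩, rfl⟩

theorem IsQuasiProductForm.exists_of_mem_L (h : IsQuasiProductForm Rq Bq Lq R₁ 0 R a B L₁ L)
    {v : Fin r ⊕ Fin d → ℤ} (hv : v ∈ Lq) : ∃ k ∈ L₁, ∃ ℓ ∈ L, Sum.elim k ℓ = v := by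
  rw [h.L_eq] at hv
  obtain ⟨p, hp, rfl⟩ := Finset.mem_image.1 hv
  exact ⟨p.1, (Finset.mem_product.1 hp).1, p.2, (Finset.mem_product.1 hp).2, rfl⟩

/-- A triple in quasi-product form with `C = 0` is a Hadamard triple. -/
theorem IsQuasiProductForm.isHadamardTriple
    (h : IsQuasiProductForm Rq Bq Lq R₁ 0 R a B L₁ L) : IsHadamardTriple Rq Bq Lq := by
  have h₁ := h.hadamard₁.expansive
  have h₂ := (h.hadamard 0).expansive
  have hR := h.R_eq
  subst hR
  have h0 : ∀ {n m : ℕ}, (Sum.elim (0 : Fin n → ℤ) (0 : Fin m → ℤ)) = 0 := fun {n m} => by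
    ext i; rcases i with i | i <;> rfl
  refine IsHadamardTriple.of_mask_eq_zero (h₁.fromBlocks h₂) ?_ ?_ ?_ ?_
  · have := h.elim_mem_B 0 (h.hadamard 0).zero_mem_B
    rwa [h.a_zero, h0] at this
  · have := h.elim_mem_L h.hadamard₁.zero_mem_L (h.hadamard 0).zero_mem_L
    rwa [h0] at this
  · have hinj : Function.Injective
        fun p : (Fin r → ℤ) × (Fin d → ℤ) => Sum.elim p.1 p.2 := fun p q hpq =>
      Prod.ext (elim_inj hpq).1 (elim_inj hpq).2
    rw [h.card_eq, h.L_eq, Finset.card_image_of_injective _ hinj, Finset.card_product,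
      ← h.hadamard₁.card_eq, Finset.card_image_of_injective _ h.a_injective]
    simp
  · intro v hv w hw hne
    obtain ⟨k, hk, ℓ, hℓ, rfl⟩ := h.exists_of_mem_L hv
    obtain ⟨k', hk', ℓ', hℓ', rfl⟩ := h.exists_of_mem_L hw
    rw [realVec_elim, realVec_elim, elim_sub_elim, dualInv_fromBlocks_mulVec_elim h₁ h₂,
      h.mask_elim]
    by_cases hℓℓ : ℓ = ℓ'
    · subst hℓℓ
      have hkk : k ≠ k' := fun hkk => hne (by rw [hkk])
      have h3 := h.hadamard₁.mask_dualInv_sub hk hk' hkk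
      rw [mask_image h.a_injective] at h3
      rw [← h3, sub_self, Matrix.mulVec_zero]
      congr 1
      refine Finset.sum_congr rfl fun i _ => ?_
      rw [mask_zero (h.hadamard i).nonempty_B, mul_one]
    · rw [Finset.sum_eq_zero fun i _ => ?_, mul_zero]
      rw [(h.hadamard i).mask_dualInv_sub hℓ hℓ' hℓℓ, mul_zero]

/-- Extreme cycles of the triple in quasi-product form project to extreme cycles. -/
theorem IsQuasiProductForm.isExtremeCycle_image
    (h : IsQuasiProductForm Rq Bq Lq R₁ 0 R a B L₁ L) {K : Set (Fin r ⊕ Fin d → ℝ)}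
    (hK : IsExtremeCycle Rq Bq Lq K) :
    IsExtremeCycle R₁ (Finset.univ.image a) L₁ ((fun x => x ∘ Sum.inl) '' K) ∧
      ∀ i, IsExtremeCycle R (B i) L ((fun x => x ∘ Sum.inr) '' K) := by
  have h₁ := h.hadamard₁.expansive
  have h₂ := (h.hadamard 0).expansive
  have hcyc : IsCycle R₁ L₁ ((fun x => x ∘ Sum.inl) '' K) ∧
      IsCycle R L ((fun x => x ∘ Sum.inr) '' K) := by
    obtain ⟨m, hm, ℓ, x, hx, hxm, rfl⟩ := hK.1
    have hstep : ∀ k < m, (ℓ k ∘ Sum.inl ∈ L₁ ∧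
        x (k + 1) ∘ Sum.inl = tau R₁ (ℓ k ∘ Sum.inl) (x k ∘ Sum.inl)) ∧
        (ℓ k ∘ Sum.inr ∈ L ∧ x (k + 1) ∘ Sum.inr = tau R (ℓ k ∘ Sum.inr) (x k ∘ Sum.inr)) := by
      intro k hk
      obtain ⟨h3, h4⟩ := hx k hk
      obtain ⟨p, hp, q, hq, hpq⟩ := h.exists_of_mem_L h3
      rw [← hpq, ← Sum.elim_comp_inl_inr (x k), h.R_eq, tau_fromBlocks_elim h₁ h₂] at h4
      rw [← hpq, h4]
      exact ⟨⟨hp, rfl⟩, hq, rfl⟩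
    refine ⟨⟨m, hm, fun k => ℓ k ∘ Sum.inl, fun k => x k ∘ Sum.inl, fun k hk => (hstep k hk).1,
      by simp only [hxm], ?_⟩, ⟨m, hm, fun k => ℓ k ∘ Sum.inr, fun k => x k ∘ Sum.inr,
      fun k hk => (hstep k hk).2, by simp only [hxm], ?_⟩⟩ <;> rw [Set.image_image]
  have hint : ∀ x ∈ K, ∀ i, ∀ b ∈ B i, ∃ z : ℤ,
      x ∘ Sum.inl ⬝ᵥ realVec (a i) + x ∘ Sum.inr ⬝ᵥ realVec b = z := by
    intro x hx i b hb
    obtain ⟨z, hz⟩ := integral_of_norm_mask_eq_one h.isHadamardTriple.zero_mem_B (hK.2 x hx) _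
      (h.elim_mem_B i hb)
    refine ⟨z, ?_⟩
    rwa [← Sum.elim_comp_inl_inr x, realVec_elim, sumElim_dotProduct_sumElim] at hz
  have hint₁ : ∀ x ∈ K, ∀ i, ∃ z : ℤ, x ∘ Sum.inl ⬝ᵥ realVec (a i) = z := by
    intro x hx i
    simpa using hint x hx i 0 (h.hadamard i).zero_mem_B
  refine ⟨⟨hcyc.1, ?_⟩, fun i => ⟨hcyc.2, ?_⟩⟩
  · rintro _ ⟨x, hx, rfl⟩
    refine norm_mask_eq_one_of_integral h.hadamard₁.nonempty_B fun b hb => ?_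
    obtain ⟨i, -, rfl⟩ := Finset.mem_image.1 hb
    exact hint₁ x hx i
  · rintro _ ⟨x, hx, rfl⟩
    refine norm_mask_eq_one_of_integral (h.hadamard i).nonempty_B fun b hb => ?_
    obtain ⟨z, hz⟩ := hint x hx i b hb
    obtain ⟨w, hw⟩ := hint₁ x hx i
    refine ⟨z - w, ?_⟩
    push_cast
    rw [← hz, ← hw]
    ring

theorem IsQuasiProductForm.hasFiniteExpansion
    (h : IsQuasiProductForm Rq Bq Lq R₁ 0 R a B L₁ L) {s : Fin r ⊕ Fin d → ℝ}
    (hs₁ : HasFiniteExpansion R₁ L₁ {b | b ∈ Finset.univ.image a} (s ∘ Sum.inl))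
    (hs₂ : HasFiniteExpansion R L {b | ∃ i, b ∈ B i} (s ∘ Sum.inr)) :
    HasFiniteExpansion Rq Lq {b | b ∈ Bq} s := by
  obtain ⟨u, hu0, hufin, hu, huint⟩ := hs₁
  obtain ⟨v, hv0, hvfin, hv, hvint⟩ := hs₂
  refine ⟨fun n => Sum.elim (u n) (v n), ?_, ?_, fun n => ?_, fun n b hb k => ?_⟩
  · simp only [hu0, hv0, Sum.elim_comp_inl_inr]
  · refine (hufin.image2 Sum.elim hvfin).subset ?_
    rintro _ ⟨n, rfl⟩
    exact Set.mem_image2_of_mem ⟨n, rfl⟩ ⟨n, rfl⟩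
  · obtain ⟨p, hp, hup⟩ := hu n
    obtain ⟨q, hq, hvq⟩ := hv n
    refine ⟨Sum.elim p q, h.elim_mem_L hp hq, ?_⟩
    simp only [h.R_eq]
    rw [transpose_fromBlocks_mulVec_elim, realVec_elim, elim_add_elim, ← hup, ← hvq]
  · obtain ⟨i, b', hb', rfl⟩ := h.exists_of_mem_B hb
    obtain ⟨z, hz⟩ := huint n (a i) (Finset.mem_image_of_mem _ (Finset.mem_univ i)) k
    obtain ⟨w, hw⟩ := hvint n b' ⟨i, hb'⟩ k
    refine ⟨z + w, ?_⟩
    rw [h.R_eq, fromBlocks_pow_mulVec_elim, realVec_elim, sumElim_dotProduct_sumElim, hz, hw]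
    push_cast
    rfl

end QuasiProduct

section Existence

variable {ι κ : Type*} [Fintype ι] [DecidableEq ι] [Finite κ] {R : Matrix ι ι ℤ}

/-- Infinite convolutions with digit sets from a finite family converge weakly. -/
theorem exists_isInfiniteConvolution_of_finite (hR : IsExpansive R) {B : κ → Finset (ι → ℤ)}
    (hB : ∀ i, (B i).Nonempty) (ω : ℕ → κ) :
    ∃ μ : ProbabilityMeasure (ι → ℝ), IsInfiniteConvolution R (fun n => B (ω n)) μ := by
  have := Fintype.ofFinite κ
  refine exists_isInfiniteConvolution hR (fun n => hB (ω n))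
    (c := ∑ i, ∑ b ∈ B i, ‖realVec b‖) fun n b hb => ?_
  exact (Finset.single_le_sum (f := fun b => ‖realVec b‖) (fun _ _ => norm_nonneg _) hb).trans
    (Finset.single_le_sum (f := fun i => ∑ b ∈ B i, ‖realVec b‖)
      (fun _ _ => Finset.sum_nonneg fun _ _ => norm_nonneg _) (Finset.mem_univ (ω n)))

end Existence

section BesselIntegral

variable {Ω κ : Type*} [MeasurableSpace Ω] {P : Measure Ω} [IsProbabilityMeasure P]

/-- Bessel's inequality for an orthonormal family of unimodular functions. -/
theorem tsum_enorm_integral_sq_le {e : κ → Ω → ℂ} (he : ∀ i, Measurable (e i))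
    (hn : ∀ i ω, ‖e i ω‖ = 1)
    (horth : Pairwise fun i j => ∫ ω, (starRingEnd ℂ) (e i ω) * e j ω ∂P = 0)
    {f : Ω → ℂ} (hf : MemLp f 2 P) :
    ∑' i, ‖∫ ω, (starRingEnd ℂ) (e i ω) * f ω ∂P‖ₑ ^ 2 ≤ ∫⁻ ω, ‖f ω‖ₑ ^ 2 ∂P := by
  have heL : ∀ i, MemLp (e i) 2 P := fun i =>
    MemLp.of_bound (he i).aestronglyMeasurable 1 (Eventually.of_forall fun ω => (hn i ω).le)
  have hin : ∀ i {g : Ω → ℂ} (hg : MemLp g 2 P),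
      inner ℂ ((heL i).toLp (e i)) (hg.toLp g) = ∫ ω, (starRingEnd ℂ) (e i ω) * g ω ∂P := by
    intro i g hg
    rw [L2.inner_def]
    refine integral_congr_ae ?_
    filter_upwards [(heL i).coeFn_toLp, hg.coeFn_toLp] with ω h1 h2
    rw [h1, h2, RCLike.inner_apply, mul_comm]
  have ho : Orthonormal ℂ fun i => (heL i).toLp (e i) := by
    refine ⟨fun i => ?_, fun i j hij => (hin i (heL j)).trans (horth hij)⟩
    have h1 := inner_self_eq_norm_sq_to_K (𝕜 := ℂ) ((heL i).toLp (e i))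
    rw [hin i (heL i)] at h1
    have h2 : ∀ ω, (starRingEnd ℂ) (e i ω) * e i ω = 1 := fun ω => by
      rw [mul_comm, Complex.mul_conj', hn]
      simp
    simp only [h2, integral_const, probReal_univ, one_smul] at h1
    have h3 : ((1 : ℝ) : ℂ) = ((‖(heL i).toLp (e i)‖ ^ 2 : ℝ) : ℂ) := by
      push_cast
      exact h1
    exact (pow_eq_one_iff_of_nonneg (norm_nonneg _) two_ne_zero).1
      (Complex.ofReal_injective h3).symm
  have hb := tsum_enorm_inner_sq_le ho (hf.toLp f)
  simp only [hin _ hf] at hb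
  refine hb.trans (le_of_eq ?_)
  rw [Lp.enorm_toLp]
  have h4 := eLpNorm_nnreal_pow_eq_lintegral (μ := P) (f := f) (p := 2) two_ne_zero
  norm_cast at h4
  simpa only [NNReal.coe_ofNat, ENNReal.coe_ofNat, ENNReal.rpow_ofNat] using h4

end BesselIntegral

section Words

theorem norm_fourierTransform_le_one {ι : Type*} [Fintype ι] (μ : Measure (ι → ℝ))
    [IsProbabilityMeasure μ] (ξ : ι → ℝ) : ‖fourierTransform μ ξ‖ ≤ 1 := by
  refine (norm_integral_le_integral_norm _).trans ?_
  simp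

theorem mask_singleton {ι : Type*} [Fintype ι] (v : ι → ℤ) (x : ι → ℝ) :
    mask {v} x = expFun x (realVec v) := by
  simp [mask_eq]

variable {N : ℕ}

theorem integral_uniformOn_univ (g : Fin N → ℂ) :
    ∫ i, g i ∂(ProbabilityTheory.uniformOn (Set.univ : Set (Fin N))) =
      (1 / (N : ℂ)) * ∑ i, g i := by
  rw [integral_fintype Integrable.of_finite, Finset.mul_sum]
  refine Finset.sum_congr rfl fun i _ => ?_
  rw [Measure.real, ProbabilityTheory.uniformOn_univ, Complex.real_smul]
  simp

variable {ι : Type*} [Fintype ι] [DecidableEq ι] {R : Matrix ι ι ℤ} {B : Fin N → Finset (ι → ℤ)}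
  {σ : (ℕ → Fin N) → ProbabilityMeasure (ι → ℝ)}

theorem measurable_fourierTransform (hR : IsExpansive R) (hB : ∀ i, (B i).Nonempty)
    (hσ : ∀ ω, IsInfiniteConvolution R (fun n => B (ω n)) (σ ω)) (ξ : ι → ℝ) :
    Measurable fun ω => fourierTransform (σ ω : Measure (ι → ℝ)) ξ := by
  refine measurable_of_tendsto_metrizable (fun n => ?_)
    (tendsto_pi_nhds.2 fun ω => (hσ ω).tendsto_prod_mask hR (fun n => hB (ω n)) ξ)
  refine Finset.measurable_fun_prod _ fun k _ => ?_
  exact (measurable_of_finite fun i => mask (B i) ((dualInv R ^ (k + 1)).mulVec ξ)).comp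
    (measurable_pi_apply k)

variable {v : ℕ → ι → ℤ} {μ : ProbabilityMeasure (ι → ℝ)}

/-- The Fourier transform of a convolution of point masses is multiplicative. -/
theorem IsInfiniteConvolution.fourierTransform_add (hR : IsExpansive R)
    (h : IsInfiniteConvolution R (fun n => {v n}) μ) (x y : ι → ℝ) :
    fourierTransform (μ : Measure (ι → ℝ)) (x + y) =
      fourierTransform (μ : Measure (ι → ℝ)) x * fourierTransform (μ : Measure (ι → ℝ)) y := by
  have ht := h.tendsto_prod_mask hR fun n => Finset.singleton_nonempty _
  refine tendsto_nhds_unique (ht (x + y)) (((ht x).mul (ht y)).congr fun n => ?_)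
  rw [← Finset.prod_mul_distrib]
  refine Finset.prod_congr rfl fun k _ => ?_
  rw [mask_singleton, mask_singleton, mask_singleton, Matrix.mulVec_add, expFun_add_left]

theorem IsInfiniteConvolution.norm_fourierTransform (hR : IsExpansive R)
    (h : IsInfiniteConvolution R (fun n => {v n}) μ) (x : ι → ℝ) :
    ‖fourierTransform (μ : Measure (ι → ℝ)) x‖ = 1 := by
  refine tendsto_nhds_unique
    (h.tendsto_prod_mask hR (fun n => Finset.singleton_nonempty _) x).norm
    (tendsto_const_nhds.congr fun n => ?_)
  rw [norm_prod]
  simp only [mask_singleton, norm_expFun, Finset.prod_const_one]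

variable [NeZero N]

instance isProbabilityMeasure_wordMeasure : IsProbabilityMeasure (wordMeasure N) := by
  unfold wordMeasure
  infer_instance

/-- The letters of a random word are independent and uniformly distributed. -/
theorem integral_prod_wordMeasure (g : ℕ → Fin N → ℂ) (n : ℕ) :
    ∫ ω, ∏ k ∈ Finset.range n, g k (ω k) ∂(wordMeasure N) =
      ∏ k ∈ Finset.range n, ((1 / (N : ℂ)) * ∑ i, g k i) := by
  have h1 := integral_restrict_infinitePi
    (μ := fun _ : ℕ => ProbabilityTheory.uniformOn (Set.univ : Set (Fin N)))
    (s := Finset.range n) (f := fun y => ∏ k : Finset.range n, g k (y k))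
    (measurable_of_finite _).aestronglyMeasurable
  rw [integral_fintype_prod_eq_prod (fun (k : Finset.range n) => g k)] at h1
  have h2 : ∀ ω : ℕ → Fin N, ∏ k ∈ Finset.range n, g k (ω k) =
      ∏ k : Finset.range n, g k ((Finset.range n).restrict ω k) := fun ω =>
    (Finset.prod_coe_sort (Finset.range n) fun k => g k (ω k)).symm
  simp only [h2]
  refine h1.trans ?_
  simp only [integral_uniformOn_univ]
  exact Finset.prod_coe_sort (Finset.range n) fun k => (1 / (N : ℂ)) * ∑ i, g k i

end Words

section QuasiProduct

variable {r d N : ℕ} [NeZero N]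
  {Rq : Matrix (Fin r ⊕ Fin d) (Fin r ⊕ Fin d) ℤ} {Bq Lq : Finset (Fin r ⊕ Fin d → ℤ)}
  {R₁ : Matrix (Fin r) (Fin r) ℤ} {R : Matrix (Fin d) (Fin d) ℤ}
  {a : Fin N → Fin r → ℤ} {B : Fin N → Finset (Fin d → ℤ)}
  {L₁ : Finset (Fin r → ℤ)} {L : Finset (Fin d → ℤ)}
  {μ : ProbabilityMeasure (Fin r ⊕ Fin d → ℝ)}
  {ν : (ℕ → Fin N) → ProbabilityMeasure (Fin r → ℝ)}
  {σ : (ℕ → Fin N) → ProbabilityMeasure (Fin d → ℝ)}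

/-- The Fourier transform of the quasi-product measure as an average over random words. -/
theorem IsQuasiProductForm.fourierTransform_elim
    (h : IsQuasiProductForm Rq Bq Lq R₁ 0 R a B L₁ L)
    (hμ : IsInfiniteConvolution Rq (fun _ => Bq) μ)
    (hν : ∀ ω, IsInfiniteConvolution R₁ (fun n => {a (ω n)}) (ν ω))
    (hσ : ∀ ω, IsInfiniteConvolution R (fun n => B (ω n)) (σ ω))
    (x : Fin r → ℝ) (y : Fin d → ℝ) :
    fourierTransform (μ : Measure (Fin r ⊕ Fin d → ℝ)) (Sum.elim x y) =
      ∫ ω, fourierTransform (ν ω : Measure (Fin r → ℝ)) x *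
        fourierTransform (σ ω : Measure (Fin d → ℝ)) y ∂(wordMeasure N) := by
  have h₁ := h.hadamard₁.expansive
  have h₂ := (h.hadamard 0).expansive
  have hq := h.isHadamardTriple
  set g : ℕ → Fin N → ℂ := fun k i =>
    expFun ((dualInv R₁ ^ (k + 1)).mulVec x) (realVec (a i)) *
      mask (B i) ((dualInv R ^ (k + 1)).mulVec y) with hg
  have hgn : ∀ k i, ‖g k i‖ ≤ 1 := fun k i => by
    rw [hg, norm_mul, norm_expFun, one_mul]
    exact norm_mask_le_one _ _
  have hlim := hμ.tendsto_prod_mask hq.expansive (fun _ => hq.nonempty_B) (Sum.elim x y)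
  have hprod : ∀ n, ∏ k ∈ Finset.range n, mask Bq ((dualInv Rq ^ (k + 1)).mulVec (Sum.elim x y)) =
      ∫ ω, ∏ k ∈ Finset.range n, g k (ω k) ∂(wordMeasure N) := by
    intro n
    rw [integral_prod_wordMeasure]
    refine Finset.prod_congr rfl fun k _ => ?_
    rw [h.R_eq, dualInv_pow_fromBlocks_mulVec_elim h₁ h₂, h.mask_elim]
  simp only [hprod] at hlim
  refine tendsto_nhds_unique hlim ?_
  refine tendsto_integral_of_dominated_convergence (fun _ => 1) (fun n => ?_)
    (integrable_const _) (fun n => Eventually.of_forall fun ω => ?_)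
    (Eventually.of_forall fun ω => ?_)
  · refine (Finset.measurable_fun_prod _ fun k _ => ?_).aestronglyMeasurable
    exact (measurable_of_finite (g k)).comp (measurable_pi_apply k)
  · rw [norm_prod]
    exact Finset.prod_le_one (fun _ _ => norm_nonneg _) fun k _ => hgn k _
  · refine (((hν ω).tendsto_prod_mask h₁ (fun n => Finset.singleton_nonempty _) x).mul
      ((hσ ω).tendsto_prod_mask h₂ (fun n => (h.hadamard (ω n)).nonempty_B) y)).congr fun n => ?_
    rw [← Finset.prod_mul_distrib]
    refine Finset.prod_congr rfl fun k _ => ?_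
    rw [mask_singleton]

variable {Λ₁ : Set (Fin r → ℝ)} {Λ₂ : Set (Fin d → ℝ)}

/-- If `Λ₁ × Λ₂` is orthogonal for the quasi-product measure, then its Parseval sum is at most
the average of the Parseval sums of `Λ₂` for the random convolutions. -/
theorem IsQuasiProductForm.tsum_le_lintegral
    (h : IsQuasiProductForm Rq Bq Lq R₁ 0 R a B L₁ L)
    (hμ : IsInfiniteConvolution Rq (fun _ => Bq) μ)
    (hν : ∀ ω, IsInfiniteConvolution R₁ (fun n => {a (ω n)}) (ν ω))
    (hσ : ∀ ω, IsInfiniteConvolution R (fun n => B (ω n)) (σ ω))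
    (hΛ₂ : Λ₂.Countable)
    (horth : ∀ s ∈ prodSet Λ₁ Λ₂, ∀ t ∈ prodSet Λ₁ Λ₂, s ≠ t →
      fourierTransform (μ : Measure (Fin r ⊕ Fin d → ℝ)) (s - t) = 0) (y : Fin d → ℝ) :
    ∑' s : prodSet Λ₁ Λ₂,
        ‖fourierTransform (μ : Measure (Fin r ⊕ Fin d → ℝ)) ((Sum.elim 0 y : Fin r ⊕ Fin d → ℝ) + s)‖ₑ ^ 2 ≤
      ∫⁻ ω, ∑' t : Λ₂, ‖fourierTransform (σ ω : Measure (Fin d → ℝ)) (y + t)‖ₑ ^ 2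
        ∂(wordMeasure N) := by
  have h₁ := h.hadamard₁.expansive
  have h₂ := (h.hadamard 0).expansive
  have := hΛ₂.to_subtype
  have hFm : ∀ ξ, Measurable fun ω => fourierTransform (σ ω : Measure (Fin d → ℝ)) ξ :=
    measurable_fourierTransform h₂ (fun i => (h.hadamard i).nonempty_B) hσ
  have hEm : ∀ ξ, Measurable fun ω => fourierTransform (ν ω : Measure (Fin r → ℝ)) ξ :=
    measurable_fourierTransform h₁ (B := fun i => {a i}) (fun i => Finset.singleton_nonempty _) hν
  have hfib : ∀ t : Λ₂,
      ∑' s : Λ₁, ‖fourierTransform (μ : Measure (Fin r ⊕ Fin d → ℝ))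
        (Sum.elim s.1 (y + t))‖ₑ ^ 2 ≤
      ∫⁻ ω, ‖fourierTransform (σ ω : Measure (Fin d → ℝ)) (y + t)‖ₑ ^ 2 ∂(wordMeasure N) := by
    intro t
    have hb := tsum_enorm_integral_sq_le (P := wordMeasure N)
      (e := fun (s : Λ₁) ω => fourierTransform (ν ω : Measure (Fin r → ℝ)) (-s.1))
      (f := fun ω => fourierTransform (σ ω : Measure (Fin d → ℝ)) (y + t))
      (fun s => hEm _) (fun s ω => (hν ω).norm_fourierTransform h₁ _) ?_
      (MemLp.of_bound (hFm _).aestronglyMeasurable 1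
        (Eventually.of_forall fun ω => norm_fourierTransform_le_one _ _))
    · simp only [← fourierTransform_neg, neg_neg] at hb
      simpa only [h.fourierTransform_elim hμ hν hσ] using hb
    · intro s s' hss
      have hne : Sum.elim s.1 t.1 ≠ Sum.elim s'.1 t.1 := fun heq =>
        hss (Subtype.ext (elim_inj heq).1)
      have h0 := horth (Sum.elim s.1 t.1) ⟨s.2, t.2⟩ (Sum.elim s'.1 t.1) ⟨s'.2, t.2⟩ hne
      rw [elim_sub_elim, sub_self, h.fourierTransform_elim hμ hν hσ] at h0
      rw [← h0]
      refine integral_congr_ae (Eventually.of_forall fun ω => ?_)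
      change (starRingEnd ℂ) (fourierTransform _ _) * fourierTransform _ _ =
        fourierTransform _ _ * fourierTransform _ 0
      rw [← fourierTransform_neg, neg_neg, ← (hν ω).fourierTransform_add h₁,
        fourierTransform_zero, mul_one, sub_eq_add_neg]
  rw [lintegral_tsum fun t => ((hFm _).enorm.pow_const 2).aemeasurable]
  let e : prodSet Λ₁ Λ₂ → Λ₂ × Λ₁ := fun s => (⟨s.1 ∘ Sum.inr, s.2.2⟩, ⟨s.1 ∘ Sum.inl, s.2.1⟩)
  have he : Function.Injective e := by
    intro s s' hss
    have h3 := congr_arg (fun p : Λ₂ × Λ₁ => Sum.elim p.2.1 p.1.1) hss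
    simp only [e, Sum.elim_comp_inl_inr] at h3
    exact Subtype.ext h3
  calc _ = ∑' s : prodSet Λ₁ Λ₂, ‖fourierTransform (μ : Measure (Fin r ⊕ Fin d → ℝ))
          (Sum.elim (e s).2.1 (y + (e s).1))‖ₑ ^ 2 := by
        refine tsum_congr fun s => ?_
        conv_lhs => rw [← Sum.elim_comp_inl_inr s.1, elim_add_elim, zero_add]
    _ ≤ ∑' p : Λ₂ × Λ₁, ‖fourierTransform (μ : Measure (Fin r ⊕ Fin d → ℝ))
          (Sum.elim p.2.1 (y + p.1))‖ₑ ^ 2 :=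
        ENNReal.tsum_comp_le_tsum_of_injective he fun p : Λ₂ × Λ₁ =>
          ‖fourierTransform (μ : Measure (Fin r ⊕ Fin d → ℝ)) (Sum.elim p.2.1 (y + p.1))‖ₑ ^ 2
    _ = ∑' t : Λ₂, ∑' s : Λ₁, ‖fourierTransform (μ : Measure (Fin r ⊕ Fin d → ℝ))
          (Sum.elim s.1 (y + t))‖ₑ ^ 2 :=
        ENNReal.tsum_prod (f := fun (t : Λ₂) (s : Λ₁) =>
          ‖fourierTransform (μ : Measure (Fin r ⊕ Fin d → ℝ)) (Sum.elim s.1 (y + t))‖ₑ ^ 2)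
    _ ≤ _ := ENNReal.tsum_le_tsum hfib

end QuasiProduct

end RandomConv

theorem mainTheorem4 {r d N : ℕ} [NeZero N]
    (Rq : Matrix (Fin r ⊕ Fin d) (Fin r ⊕ Fin d) ℤ) (Bq Lq : Finset (Fin r ⊕ Fin d → ℤ))
    (R₁ : Matrix (Fin r) (Fin r) ℤ) (C : Matrix (Fin d) (Fin r) ℤ)
    (R : Matrix (Fin d) (Fin d) ℤ)
    (a : Fin N → Fin r → ℤ) (B : Fin N → Finset (Fin d → ℤ))
    (L₁ : Finset (Fin r → ℤ)) (L : Finset (Fin d → ℤ))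
    (hqp : RandomConv.IsQuasiProductForm Rq Bq Lq R₁ C R a B L₁ L)
    (hC : C = 0)
    (hsimple : RandomConv.IsDynamicallySimple Rq Bq Lq)
    (Λ₁ : Set (Fin r → ℝ)) (Λ₂ : Set (Fin d → ℝ))
    (hΛ₁ : Λ₁ = RandomConv.generatedSet R₁ L₁
      (⋃₀ {K | RandomConv.IsExtremeCycle R₁ (Finset.univ.image a) L₁ K}))
    (hΛ₂ : Λ₂ = RandomConv.generatedSet R L
      (⋃₀ {K | ∀ i, RandomConv.IsExtremeCycle R (B i) L K})) :
    (∃ μ : MeasureTheory.ProbabilityMeasure (Fin r ⊕ Fin d → ℝ),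
      RandomConv.IsInfiniteConvolution Rq (fun _ => Bq) μ ∧
        RandomConv.IsSpectrum (RandomConv.prodSet Λ₁ Λ₂) μ) ∧
    ∀ᵐ ω ∂(RandomConv.wordMeasure N),
      ∃ μ : MeasureTheory.ProbabilityMeasure (Fin d → ℝ),
        RandomConv.IsInfiniteConvolution R (fun n => B (ω n)) μ ∧
          RandomConv.IsSpectrum Λ₂ μ := by
  open RandomConv in
  subst hC
  have h₁ := hqp.hadamard₁.expansive
  have h₂ := (hqp.hadamard 0).expansive
  have hq := hqp.isHadamardTriple
  have hexp₁ : ∀ s ∈ Λ₁, HasFiniteExpansion R₁ L₁ {b | b ∈ Finset.univ.image a} s := by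
    intro s hs
    rw [hΛ₁] at hs
    exact hasFiniteExpansion_of_mem_generatedSet h₁ (fun K hK => hK.1)
      (fun K hK c hc => integral_of_norm_mask_eq_one hqp.hadamard₁.zero_mem_B (hK.2 c hc)) hs
  have hexp₂ : ∀ s ∈ Λ₂, HasFiniteExpansion R L {b | ∃ i, b ∈ B i} s := by
    intro s hs
    rw [hΛ₂] at hs
    refine hasFiniteExpansion_of_mem_generatedSet h₂ (fun K hK => (hK 0).1) ?_ hs
    rintro K hK c hc b ⟨i, hb⟩
    exact integral_of_norm_mask_eq_one (hqp.hadamard i).zero_mem_B ((hK i).2 c hc) b hb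
  have hexp : ∀ s ∈ prodSet Λ₁ Λ₂, HasFiniteExpansion Rq Lq {b | b ∈ Bq} s := fun s hs =>
    hqp.hasFiniteExpansion (hexp₁ _ hs.1) (hexp₂ _ hs.2)
  obtain ⟨μ, hμ⟩ := exists_isInfiniteConvolution_of_finite (κ := Unit) (B := fun _ => Bq)
    hq.expansive (fun _ => hq.nonempty_B) fun _ => ()
  have horth := hμ.fourierTransform_sub_eq_zero (fun _ => hq) (fun _ b hb => hb) hexp
  have hone : ∀ x, 1 ≤ ∑' s : prodSet Λ₁ Λ₂,
      ‖fourierTransform (μ : Measure (Fin r ⊕ Fin d → ℝ)) (x + s)‖ₑ ^ 2 := by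
    refine hq.one_le_tsum hsimple (continuous_fourierTransform _) (fourierTransform_zero _)
      (hμ.fourierTransform_eq_mask_mul hq.expansive hq.nonempty_B) ?_ ?_ ?_
    · intro K hK c hc
      obtain ⟨hK₁, hK₂⟩ := hqp.isExtremeCycle_image hK
      refine ⟨?_, ?_⟩
      · rw [hΛ₁]
        exact neg_mem_generatedSet ⟨_, hK₁, c, hc, rfl⟩
      · rw [hΛ₂]
        exact neg_mem_generatedSet ⟨_, hK₂, c, hc, rfl⟩
    · intro s hs v hv
      obtain ⟨k, hk, ℓ, hℓ, rfl⟩ := hqp.exists_of_mem_L hv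
      rw [hqp.R_eq, ← Sum.elim_comp_inl_inr s, transpose_fromBlocks_mulVec_elim, realVec_elim,
        elim_add_elim]
      refine ⟨?_, ?_⟩
      · have := hs.1
        rw [hΛ₁] at this ⊢
        exact mulVec_add_mem_generatedSet this hk
      · have := hs.2
        rw [hΛ₂] at this ⊢
        exact mulVec_add_mem_generatedSet this hℓ
    · intro s hs b hb
      exact integral_of_mem_integralVectors (hexp s hs).mem_integralVectors hb
  refine ⟨⟨μ, hμ, isSpectrum_of_one_le_tsum horth dense_univ fun x _ => hone x⟩, ?_⟩
  choose ν hν using exists_isInfiniteConvolution_of_finite (B := fun i => {a i}) h₁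
    fun i => Finset.singleton_nonempty _
  choose σ hσ using exists_isInfiniteConvolution_of_finite (B := B) h₂
    fun i => (hqp.hadamard i).nonempty_B
  have horth₂ : ∀ ω, ∀ s ∈ Λ₂, ∀ t ∈ Λ₂, s ≠ t →
      fourierTransform (σ ω : Measure (Fin d → ℝ)) (s - t) = 0 := fun ω =>
    (hσ ω).fourierTransform_sub_eq_zero (fun n => hqp.hadamard (ω n))
      (fun n b hb => show ∃ i, b ∈ B i from ⟨ω n, hb⟩) hexp₂
  have hle : ∀ ω y, ∑' t : Λ₂, ‖fourierTransform (σ ω : Measure (Fin d → ℝ)) (y + t)‖ₑ ^ 2 ≤ 1 :=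
    fun ω => tsum_fourierTransform_le_one (orthonormal_expLp (horth₂ ω))
  have hcount : Λ₂.Countable :=
    countable_of_orthonormal_expLp (orthonormal_expLp (horth₂ fun _ => 0))
  have hae : ∀ y, ∀ᵐ ω ∂(wordMeasure N),
      ∑' t : Λ₂, ‖fourierTransform (σ ω : Measure (Fin d → ℝ)) (y + t)‖ₑ ^ 2 = 1 := by
    intro y
    refine ae_eq_of_ae_le_of_lintegral_le (g := fun _ => 1) (Eventually.of_forall fun ω => hle ω y)
      ?_ aemeasurable_const ?_
    · refine ((lintegral_mono fun ω => hle ω y).trans_lt ?_).ne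
      simp
    · refine le_trans ?_ ((hone (Sum.elim 0 y)).trans (hqp.tsum_le_lintegral hμ hν hσ hcount horth y))
      simp
  obtain ⟨S, hSc, hSd⟩ := TopologicalSpace.exists_countable_dense (Fin d → ℝ)
  filter_upwards [(ae_ball_iff hSc).2 fun y _ => hae y] with ω hω
  exact ⟨σ ω, hσ ω, isSpectrum_of_one_le_tsum (horth₂ ω) hSd fun y hy => (hω y hy).ge⟩
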